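/- Let $q\in\mathbb C$ with $0<|q|<1$, let $q^{1/2}$ be a fixed square root of $q$, and let $(x;q)_n=\prod_{j=0}^{n-1}(1-xq^j)$ for $n\in\mathbb Z_{\ge 0}\cup\{\infty\}$, $(x_1,\dots,x_m;q)_n=\prod_r(x_r;q)_n$. In compact quotients everything after the slash is in the denominator, so $c/de=c/(de)$. **Taylor remainders.** For a function $f$ put $$(D_qf)(z)=\frac{f(q^{1/2}z)-f(q^{-1/2}z)}{(q^{1/2}-q^{-1/2})(z-z^{-1})/2},$$ $$D_{c,q}=(1-czq^{-1/2})(1-czq^{1/2})(1-cq^{-1/2}/z)(1-cq^{1/2}/z)\,D_q,$$ $D^{(0)}_{c,q}=\mathrm{Id}$, $D^{(k)}_{c,q}=D_{cq^{3(k-1)/2},q}\,D^{(k-1)}_{c,q}$ for $k\ge1$, and $$\Phi_k(z;a,c)=\frac{(az,a/z;q)_k}{(cz,c/z;q)_k},\qquad t_k^{(a,c)}(f)=\frac{(-1)^kq^{-k(k-1)/4}(1-q)^k}{(2a)^k(q,c/a,acq^{k-1};q)_k}\Bigl[D^{(k)}_{c,q}f(z)\Bigr]_{z=aq^{k/2}},$$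 $$R_n^{(a,c)}f(z)=f(z)-\sum_{k=0}^n t_k^{(a,c)}(f)\,\Phi_k(z;a,c).$$ **The kernels.** For $b,c,d,e\in\mathbb C\setminus\{0\}$ put $$A(z)=\frac{(cz/de,c/dez;q)_\infty}{(c^2z/bde,c^2/bdez;q)_\infty},\qquad B(z)=\frac{(bz,b/z;q)_\infty}{(cz,c/z;q)_\infty},\qquad \Psi_k(z)=\Phi_k\bigl(z;c/de,c^2/bde\bigr),$$ $$H(z)=\frac{(cz/d,c/dz,cz/e,c/ez;q)_\infty}{(cz,c/z,cz/de,c/dez;q)_\infty},\qquad K(z)=\frac{(cz/d,c/dz,cz/e,c/ez;q)_\infty}{(bz,b/z,c^2z/bde,c^2/bdez;q)_\infty},$$ $$f_k=\frac{1-bcq^{2k-1}}{1-bcq^{-1}}\frac{(bcq^{-1},d,e,c^2/deq;q)_k}{(q,bc/d,bc/e,bdeq/c;q)_k}q^k,$$ $$g_k=\frac{1-c^3q^{2k-1}/bd^2e^2}{1-c^3/bd^2e^2q}\frac{(c^3/bd^2e^2q,c/bd,c/be,c^2/deq;q)_k}{(q,c^2/de^2,c^2/d^2e,cq/bde;q)_k}q^k.$$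 **Genericity.** Assume that the denominators of $H(b)$, $K(c/de)$ and of all $f_k$, $g_k$ are nonzero, that $H$ has no vanishing denominator factor at any point $bq^m$ and $K$ none at any point $(c/de)q^m$ $(m\ge0)$, and that $b^2q^i\ne1$ and $(c/de)^2q^i\neq1$ for all $i\ge1$ (so that the divided differences defining the Taylor coefficients below are defined). **Statement.** Let $\Omega_H$ be the set of $z\in\mathbb C\setminus\{0\}$ at which $(cz,c/z,c^2z/bde,c^2/bdez,cz/de,c/dez;q)_\infty\ne0$, and $\Omega_K$ the set of $z\in\mathbb C\setminus\{0\}$ at which $(cz,c/z,c^2z/bde,c^2/bdez,bz,b/z;q)_\infty\neq0$. (i) For all $z\in\Omega_H$ and $n\ge0$ the series below converge absolutely, and $$A(z)R_n^{(b,c)}H(z)=A(z)H(b)\sum_{k=n+1}^\infty f_k\Phi_k(z;b,c)+B(z)K(c/de)\sum_{k=0}^\infty g_k\Psi_k(z).$$ Hence, as $n\to\infty$, $$A(z)R_n^{(b,c)}H(z)\longrightarrow B(z)K(c/de)\sum_{k=0}^\infty g_k\Psi_k(z)$$ uniformly on compact subsets of $\Omega_H$; and if $K(c/de)\neq0$,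 this limit does not vanish identically on $\Omega_H$. (ii) For all $z\in\Omega_K$ and $n\ge0$ the series below converge absolutely, and $$B(z)R_n^{(c/de,\,c^2/bde)}K(z)=B(z)K(c/de)\sum_{k=n+1}^\infty g_k\Psi_k(z)+A(z)H(b)\sum_{k=0}^\infty f_k\Phi_k(z;b,c).$$ Hence, as $n\to\infty$, $$B(z)R_n^{(c/de,\,c^2/bde)}K(z)\longrightarrow A(z)H(b)\sum_{k=0}^\infty f_k\Phi_k(z;b,c)$$ uniformly on compact subsets of $\Omega_K$; and if $H(b)\ne0$, this limit does not vanish identically on $\Omega_K$. -/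

import Mathlib

namespace WPTaylor

noncomputable section

/-! ### `q`-shifted factorials -/

/-- The finite `q`-shifted factorial `(x; q)_n`. -/
def qPoch (q x : ℂ) (n : ℕ) : ℂ := ∏ j ∈ Finset.range n, (1 - x * q ^ j)

/-- The infinite `q`-shifted factorial `(x; q)_∞`. -/
def qPochInf (q x : ℂ) : ℂ := ∏' j : ℕ, (1 - x * q ^ j)

/-- No factor of `(x; q)_∞` vanishes; so `(x; q)_∞` and every `(x; q)_n` may be divided by. -/
def QRegular (q x : ℂ) : Prop := ∀ m : ℕ, x * q ^ m ≠ 1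

/-! ### The well-poised Taylor calculus

Throughout, `s` is a fixed square root `q^{1/2}` of `q`. -/

/-- The well-poised monomial `Φ_k(z; a, c) = (az, a/z; q)_k / (cz, c/z; q)_k`. -/
def Phi (q a c : ℂ) (k : ℕ) (z : ℂ) : ℂ :=
  (qPoch q (a * z) k * qPoch q (a / z) k) / (qPoch q (c * z) k * qPoch q (c / z) k)

/-- The Askey–Wilson divided-difference operator `D_q`. -/
def askeyWilsonD (s : ℂ) (f : ℂ → ℂ) (z : ℂ) : ℂ :=
  (f (s * z) - f (s⁻¹ * z)) / ((s - s⁻¹) * (z - z⁻¹) / 2)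

/-- The well-poised operator `D_{c,q}`. -/
def wpD (s c : ℂ) (f : ℂ → ℂ) (z : ℂ) : ℂ :=
  (1 - c * z * s⁻¹) * (1 - c * z * s) * (1 - c * s⁻¹ / z) * (1 - c * s / z) * askeyWilsonD s f z

/-- The iterated operators `D_{c,q}^{(0)} = Id`, `D_{c,q}^{(k+1)} = D_{c q^{3k/2}, q} D_{c,q}^{(k)}`. -/
def wpDIter (s c : ℂ) : ℕ → (ℂ → ℂ) → ℂ → ℂ
  | 0, f => f
  | k + 1, f => wpD s (c * s ^ (3 * k)) (wpDIter s c k f)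

/-- The well-poised Taylor coefficient `t_k^{(a,c)}(f)`; here `q^{k(k-1)/4} = s ^ (k choose 2)`
and `c a q^{k-1} = c a q^k / q`. -/
def taylorCoeff (q s a c : ℂ) (f : ℂ → ℂ) (k : ℕ) : ℂ :=
  (-1) ^ k * (s ^ k.choose 2)⁻¹ * (1 - q) ^ k /
      ((2 * a) ^ k * (qPoch q q k * qPoch q (c / a) k * qPoch q (a * c * q ^ k / q) k)) *
    wpDIter s c k f (a * s ^ k)

/-- The `n`th Taylor sum `T_n^{(a,c)} f`. -/
def taylorSum (q s a c : ℂ) (f : ℂ → ℂ) (n : ℕ) (z : ℂ) : ℂ :=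
  ∑ k ∈ Finset.range (n + 1), taylorCoeff q s a c f k * Phi q a c k z

/-- The `n`th Taylor remainder `R_n^{(a,c)} f`. -/
def taylorRemainder (q s a c : ℂ) (f : ℂ → ℂ) (n : ℕ) (z : ℂ) : ℂ :=
  f z - taylorSum q s a c f n z

/-! ### The two-basis kernel -/

/-- The complementary basis `Ψ_k(z; b, c, d, e)`. -/
def Psi (q b c d e : ℂ) (k : ℕ) (z : ℂ) : ℂ :=
  (qPoch q (c * z / (d * e)) k * qPoch q (c / (d * e * z)) k) /
    (qPoch q (c ^ 2 * z / (b * d * e)) k * qPoch q (c ^ 2 / (b * d * e * z)) k)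

/-- The prefactor `A(z)`. -/
def prefA (q b c d e z : ℂ) : ℂ :=
  (qPochInf q (c * z / (d * e)) * qPochInf q (c / (d * e * z))) /
    (qPochInf q (c ^ 2 * z / (b * d * e)) * qPochInf q (c ^ 2 / (b * d * e * z)))

/-- The prefactor `B(z)`. -/
def prefB (q b c z : ℂ) : ℂ :=
  (qPochInf q (b * z) * qPochInf q (b / z)) / (qPochInf q (c * z) * qPochInf q (c / z))

/-- The normalized kernel `H(z)`. -/
def kernH (q c d e z : ℂ) : ℂ :=
  (qPochInf q (c * z / d) * qPochInf q (c / (d * z)) *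
      qPochInf q (c * z / e) * qPochInf q (c / (e * z))) /
    (qPochInf q (c * z) * qPochInf q (c / z) *
      qPochInf q (c * z / (d * e)) * qPochInf q (c / (d * e * z)))

/-- The normalized kernel `K(z)`. -/
def kernK (q b c d e z : ℂ) : ℂ :=
  (qPochInf q (c * z / d) * qPochInf q (c / (d * z)) *
      qPochInf q (c * z / e) * qPochInf q (c / (e * z))) /
    (qPochInf q (b * z) * qPochInf q (b / z) *
      qPochInf q (c ^ 2 * z / (b * d * e)) * qPochInf q (c ^ 2 / (b * d * e * z)))

/-- The coefficient `f_k`. -/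
def coeffF (q b c d e : ℂ) (k : ℕ) : ℂ :=
  (1 - b * c * q ^ (2 * k) / q) / (1 - b * c / q) *
    ((qPoch q (b * c / q) k * qPoch q d k * qPoch q e k * qPoch q (c ^ 2 / (d * e * q)) k) /
      (qPoch q q k * qPoch q (b * c / d) k * qPoch q (b * c / e) k *
        qPoch q (b * d * e * q / c) k)) * q ^ k

/-- The coefficient `g_k`. -/
def coeffG (q b c d e : ℂ) (k : ℕ) : ℂ :=
  (1 - c ^ 3 * q ^ (2 * k) / (b * d ^ 2 * e ^ 2 * q)) / (1 - c ^ 3 / (b * d ^ 2 * e ^ 2 * q)) *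
    ((qPoch q (c ^ 3 / (b * d ^ 2 * e ^ 2 * q)) k * qPoch q (c / (b * d)) k *
        qPoch q (c / (b * e)) k * qPoch q (c ^ 2 / (d * e * q)) k) /
      (qPoch q q k * qPoch q (c ^ 2 / (d * e ^ 2)) k * qPoch q (c ^ 2 / (d ^ 2 * e)) k *
        qPoch q (c * q / (b * d * e)) k)) * q ^ k

/-- Genericity of the parameters: the denominators that do not involve `z` are nonzero. -/
structure Generic (q b c d e : ℂ) : Prop where
  b_ne : b ≠ 0
  c_ne : c ≠ 0
  d_ne : d ≠ 0
  e_ne : e ≠ 0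
  -- the denominators of `H(b)` and `K(c/de)`
  reg_bc : QRegular q (b * c)
  reg_c_div_b : QRegular q (c / b)
  reg_bc_div_de : QRegular q (b * c / (d * e))
  reg_c_div_bde : QRegular q (c / (b * d * e))
  reg_bde_div_c : QRegular q (b * d * e / c)
  reg_c3 : QRegular q (c ^ 3 / (b * d ^ 2 * e ^ 2))
  -- the remaining denominators of `f_k` and `g_k`
  bc_ne_q : b * c ≠ q
  reg_bc_div_d : QRegular q (b * c / d)
  reg_bc_div_e : QRegular q (b * c / e)
  c3_ne_q : c ^ 3 / (b * d ^ 2 * e ^ 2) ≠ q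
  reg_c2_div_de2 : QRegular q (c ^ 2 / (d * e ^ 2))
  reg_c2_div_d2e : QRegular q (c ^ 2 / (d ^ 2 * e))
  -- together with the above: the grids `b q^m` and `(c/de) q^m` avoid the poles of `H` and `K`
  reg_b_div_c : QRegular q (b / c)
  -- `z - 1/z ≠ 0` at the points `b q^{i/2}` and `(c/de) q^{i/2}`, `i ≥ 1`, where the
  -- divided differences are taken
  grid_b : ∀ i : ℕ, 1 ≤ i → b ^ 2 * q ^ i ≠ 1
  grid_c_div_de : ∀ i : ℕ, 1 ≤ i → (c / (d * e)) ^ 2 * q ^ i ≠ 1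

/-- The points of `ℂ^*` off the pole sets of both bases `Φ_k` and `Ψ_k`. -/
def poleFree (q b c d e : ℂ) : Set ℂ :=
  {z | z ≠ 0 ∧ QRegular q (c * z) ∧ QRegular q (c / z) ∧
    QRegular q (c ^ 2 * z / (b * d * e)) ∧ QRegular q (c ^ 2 / (b * d * e * z))}

/-- The admissible points for the expansion of `A · R_n H`: off the pole sets, and off the
remaining denominator zeros of `H`. -/
def admissibleH (q b c d e : ℂ) : Set ℂ :=
  {z | z ∈ poleFree q b c d e ∧ QRegular q (c * z / (d * e)) ∧ QRegular q (c / (d * e * z))}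

/-- The admissible points for the expansion of `B · R_n K`: off the pole sets, and off the
remaining denominator zeros of `K`. -/
def admissibleK (q b c d e : ℂ) : Set ℂ :=
  {z | z ∈ poleFree q b c d e ∧ QRegular q (b * z) ∧ QRegular q (b / z)}

/-- The `(b,c)`-basis contribution `A(z) H(b) ∑_{k ≥ 0} f_k Φ_k(z; b, c)`. -/
def contribPhi (q b c d e z : ℂ) : ℂ :=
  prefA q b c d e z * kernH q c d e b * ∑' k : ℕ, coeffF q b c d e k * Phi q b c k z

/-- The complementary contribution `B(z) K(c/de) ∑_{k ≥ 0} g_k Ψ_k(z; b, c, d, e)`. -/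
def contribPsi (q b c d e z : ℂ) : ℂ :=
  prefB q b c z * kernK q b c d e (c / (d * e)) *
    ∑' k : ℕ, coeffG q b c d e k * Psi q b c d e k z

end

end WPTaylor

/-!
Well-poised partial fractions for the kernel are a nonterminating well-poised summation: cleared of
its `z`-dependent denominators, the sum of the two series is a function `T(u, v)` of the numerator
parameters `u = c/d`, `v = c/e`. Contiguity in `v` telescopes each series up to a boundary term, and
the two boundary terms are antisymmetric under the exchange of the base points `b` and
`β = c/de`, so `T(u, v)` is an explicit factor times `T(u, vq)`. Iterating in `v` and then in `u`
reduces `T(u, v)` to `T(0, 0)`, which is read off at the degenerate point `u = β`, `v = 0`, where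
one of the two series vanishes and the other has a single term.

The Taylor coefficients of `H` are known exactly because `D_{c,q}` maps the kernel with parameters
`(c, d, e)` to a multiple of the one with parameters `(c q^{3/2}, d q, e q)`; evaluating at
`z = b q^{k/2}` gives `t_k(H) = H(b) f_k`. The remainder is therefore a tail of the first series
plus the whole second one. The involution `(b, c, d, e) ↦ (c/de, c²/bde, c/be, c/bd)` exchanges
`H` with `K`, `Φ` with `Ψ`, `f` with `g` and `A` with `B`, which turns the expansion of `H` into
that of `K`.
-/

open Filter Topology Asymptotics

namespace WPTaylor

section QPochhammer

variable {q x z : ℂ}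

@[simp] lemma qPoch_zero (q x : ℂ) : qPoch q x 0 = 1 := Finset.prod_range_zero _

lemma qPoch_succ (q x : ℂ) (n : ℕ) : qPoch q x (n + 1) = qPoch q x n * (1 - x * q ^ n) :=
  Finset.prod_range_succ _ _

lemma qPoch_add (q x : ℂ) (m n : ℕ) :
    qPoch q x (m + n) = qPoch q x m * qPoch q (x * q ^ m) n := by
  simp only [qPoch, Finset.prod_range_add, pow_add, mul_assoc]

lemma qPoch_succ' (q x : ℂ) (n : ℕ) : qPoch q x (n + 1) = (1 - x) * qPoch q (x * q) n := by
  rw [add_comm, qPoch_add, pow_one, qPoch_succ, qPoch_zero, one_mul, pow_zero, mul_one]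

lemma qPoch_one_succ (q : ℂ) (n : ℕ) : qPoch q 1 (n + 1) = 0 := by
  rw [qPoch_succ', sub_self, zero_mul]

lemma QRegular.one_sub_mul_pow_ne_zero (hx : QRegular q x) (n : ℕ) : 1 - x * q ^ n ≠ 0 :=
  sub_ne_zero.2 (hx n).symm

lemma QRegular.one_sub_ne_zero (hx : QRegular q x) : 1 - x ≠ 0 := by
  simpa only [pow_zero, mul_one] using hx.one_sub_mul_pow_ne_zero 0

lemma QRegular.qPoch_ne_zero (hx : QRegular q x) (n : ℕ) : qPoch q x n ≠ 0 :=
  Finset.prod_ne_zero_iff.2 fun j _ => hx.one_sub_mul_pow_ne_zero j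

lemma QRegular.mul_pow (hx : QRegular q x) (n : ℕ) : QRegular q (x * q ^ n) := fun m => by
  rw [mul_assoc, ← pow_add]
  exact hx (n + m)

lemma QRegular.mul_q (hx : QRegular q x) : QRegular q (x * q) := by
  simpa only [pow_one] using hx.mul_pow 1

lemma qRegular_zero (q : ℂ) : QRegular q 0 := fun m => by
  rw [zero_mul]
  exact zero_ne_one

lemma qRegular_self (hq1 : ‖q‖ < 1) : QRegular q q := fun m h => by
  have hlt : ‖q ^ (m + 1)‖ < 1 := by
    rw [norm_pow]
    exact pow_lt_one₀ (norm_nonneg q) hq1 m.succ_ne_zero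
  rw [pow_succ', h, norm_one] at hlt
  exact hlt.false

lemma summable_norm_mul_pow (hq1 : ‖q‖ < 1) (x : ℂ) : Summable fun j : ℕ => ‖-(x * q ^ j)‖ := by
  simpa only [norm_neg, norm_mul, norm_pow] using
    (summable_geometric_of_lt_one (norm_nonneg q) hq1).mul_left ‖x‖

lemma tendsto_qPoch (hq1 : ‖q‖ < 1) (x : ℂ) :
    Tendsto (qPoch q x) atTop (𝓝 (qPochInf q x)) := by
  have := (multipliable_one_add_of_summable (summable_norm_mul_pow hq1 x)).tendsto_prod_tprod_nat
  simp only [← sub_eq_add_neg] at this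
  exact this

lemma qPochInf_eq_qPoch_mul (hq1 : ‖q‖ < 1) (x : ℂ) (n : ℕ) :
    qPochInf q x = qPoch q x n * qPochInf q (x * q ^ n) := by
  have hshift := (tendsto_add_atTop_iff_nat n).2 (tendsto_qPoch hq1 x)
  simp only [add_comm _ n, qPoch_add] at hshift
  exact tendsto_nhds_unique hshift ((tendsto_qPoch hq1 (x * q ^ n)).const_mul (qPoch q x n))

lemma qPochInf_eq_one_sub_mul (hq1 : ‖q‖ < 1) (x : ℂ) :
    qPochInf q x = (1 - x) * qPochInf q (x * q) := by
  simpa [qPoch] using qPochInf_eq_qPoch_mul hq1 x 1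

lemma qPochInf_zero (q : ℂ) : qPochInf q 0 = 1 := by simp [qPochInf]

lemma qPochInf_one (hq1 : ‖q‖ < 1) : qPochInf q 1 = 0 := by
  rw [qPochInf_eq_one_sub_mul hq1, sub_self, zero_mul]

lemma QRegular.qPochInf_ne_zero (hx : QRegular q x) (hq1 : ‖q‖ < 1) : qPochInf q x ≠ 0 := by
  have := tprod_one_add_ne_zero_of_summable (f := fun j : ℕ => -(x * q ^ j))
    (fun j => by simpa only [← sub_eq_add_neg] using hx.one_sub_mul_pow_ne_zero j)
    (summable_norm_mul_pow hq1 x)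
  simp only [← sub_eq_add_neg] at this
  exact this

@[fun_prop]
lemma continuous_qPoch (q : ℂ) (n : ℕ) : Continuous fun x => qPoch q x n := by
  unfold qPoch
  fun_prop

@[fun_prop]
lemma continuous_qPochInf (hq1 : ‖q‖ < 1) : Continuous fun x => qPochInf q x := by
  refine continuous_iff_continuousAt.2 fun x => ?_
  have hbound : ∀ᶠ y in 𝓝 x, ∀ j : ℕ, ‖-(y * q ^ j)‖ ≤ (‖x‖ + 1) * ‖q‖ ^ j := by
    filter_upwards [continuous_norm.continuousAt.eventually_le_const (lt_add_one ‖x‖)] with y hy j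
    rw [norm_neg, norm_mul, norm_pow]
    gcongr
  have := tendsto_tprod_one_add_of_dominated_convergence (g := fun j => -(x * q ^ j))
    ((summable_geometric_of_lt_one (norm_nonneg q) hq1).mul_left (‖x‖ + 1))
    (fun j => (tendsto_id.mul_const (q ^ j)).neg) hbound
  simp only [← sub_eq_add_neg] at this
  exact this

/-- The product `(xz, x/z; q)_∞`, out of which the kernels `H`, `K` and the prefactors `A`, `B` are
built. -/
noncomputable def qPochPair (q x z : ℂ) : ℂ := qPochInf q (x * z) * qPochInf q (x / z)

lemma qPochPair_ne_zero (hq1 : ‖q‖ < 1) (hmul : QRegular q (x * z)) (hdiv : QRegular q (x / z)) :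
    qPochPair q x z ≠ 0 :=
  mul_ne_zero (hmul.qPochInf_ne_zero hq1) (hdiv.qPochInf_ne_zero hq1)

lemma qPochPair_eq_qPoch_mul (hq1 : ‖q‖ < 1) (x z : ℂ) (n : ℕ) :
    qPochPair q x z = qPoch q (x * z) n * qPoch q (x / z) n * qPochPair q (x * q ^ n) z := by
  rw [qPochPair, qPochPair, qPochInf_eq_qPoch_mul hq1 (x * z) n,
    qPochInf_eq_qPoch_mul hq1 (x / z) n]
  ring_nf

lemma qPochPair_eq_mul_mul_q (hq1 : ‖q‖ < 1) (x z : ℂ) :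
    qPochPair q x z = (1 - x * z) * (1 - x / z) * qPochPair q (x * q) z := by
  simpa [qPoch] using qPochPair_eq_qPoch_mul hq1 x z 1

lemma continuousAt_qPochPair (hq1 : ‖q‖ < 1) (x : ℂ) (hz : z ≠ 0) :
    ContinuousAt (qPochPair q x) z := by
  unfold qPochPair
  fun_prop (disch := assumption)

end QPochhammer

section Bounds

variable {q x : ℂ} {ι : Type*} {l : Filter ι} {f : ι → ℂ}

lemma norm_qPoch_le (hq1 : ‖q‖ < 1) (x : ℂ) (n : ℕ) :
    ‖qPoch q x n‖ ≤ Real.exp (‖x‖ * (1 - ‖q‖)⁻¹) := by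
  have hgeom : ∑ j ∈ Finset.range n, ‖q‖ ^ j ≤ (1 - ‖q‖)⁻¹ := by
    rw [← tsum_geometric_of_lt_one (norm_nonneg q) hq1]
    exact (summable_geometric_of_lt_one (norm_nonneg q) hq1).sum_le_tsum _
      fun _ _ => pow_nonneg (norm_nonneg q) _
  calc ‖qPoch q x n‖ = ∏ j ∈ Finset.range n, ‖1 + -(x * q ^ j)‖ := by
        simp only [qPoch, norm_prod, sub_eq_add_neg]
    _ ≤ ∏ j ∈ Finset.range n, (1 + ‖-(x * q ^ j)‖) :=
        Finset.prod_le_prod (fun _ _ => norm_nonneg _)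
          fun j _ => (norm_add_le _ _).trans_eq (by rw [norm_one])
    _ ≤ Real.exp (∑ j ∈ Finset.range n, ‖-(x * q ^ j)‖) :=
        Real.prod_one_add_le_exp_sum _ fun _ => norm_nonneg _
    _ = Real.exp (‖x‖ * ∑ j ∈ Finset.range n, ‖q‖ ^ j) := by
        simp only [norm_neg, norm_mul, norm_pow, Finset.mul_sum]
    _ ≤ _ := by gcongr

lemma norm_qPochInf_le (hq1 : ‖q‖ < 1) (x : ℂ) :
    ‖qPochInf q x‖ ≤ Real.exp (‖x‖ * (1 - ‖q‖)⁻¹) :=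
  le_of_tendsto (tendsto_qPoch hq1 x).norm (Eventually.of_forall (norm_qPoch_le hq1 x))

lemma norm_mul_pow_le (hq1 : ‖q‖ < 1) (x : ℂ) (n : ℕ) : ‖x * q ^ n‖ ≤ ‖x‖ := by
  rw [norm_mul, norm_pow]
  exact mul_le_of_le_one_right (norm_nonneg x) (pow_le_one₀ (norm_nonneg q) hq1.le)

/-! In an estimate along `l ×ˢ ⊤` the constant is uniform in the second variable. -/

lemma isBigO_one_mul {α : Type*} {l : Filter α} {f g : α → ℂ}
    (hf : f =O[l] fun _ => (1 : ℝ)) (hg : g =O[l] fun _ => (1 : ℝ)) :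
    (fun a => f a * g a) =O[l] fun _ => (1 : ℝ) :=
  (hf.mul hg).congr_right fun _ => one_mul 1

lemma isBigO_comp_fst {E : Type*} [NormedAddCommGroup E] {g : ι → E} {y : E}
    (hg : Tendsto g l (𝓝 y)) : (fun p : ι × ℕ => g p.1) =O[l ×ˢ ⊤] fun _ => (1 : ℝ) :=
  (hg.comp tendsto_fst).isBigO_one ℝ

lemma isBigO_mul_pow (hq1 : ‖q‖ < 1) (hf : Tendsto f l (𝓝 x)) (n : ℕ → ℕ) :
    (fun p : ι × ℕ => f p.1 * q ^ n p.2) =O[l ×ˢ ⊤] fun _ => (1 : ℝ) :=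
  (isBigO_of_le _ fun _ => norm_mul_pow_le hq1 _ _).trans (isBigO_comp_fst hf)

lemma isBigO_exp_norm (hf : Tendsto f l (𝓝 x)) (C : ℝ) :
    (fun p : ι × ℕ => Real.exp (‖f p.1‖ * C)) =O[l ×ˢ ⊤] fun _ => (1 : ℝ) :=
  isBigO_comp_fst ((Real.continuous_exp.tendsto _).comp (hf.norm.mul_const C))

lemma isBigO_qPoch (hq1 : ‖q‖ < 1) (hf : Tendsto f l (𝓝 x)) :
    (fun p : ι × ℕ => qPoch q (f p.1) p.2) =O[l ×ˢ ⊤] fun _ => (1 : ℝ) :=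
  .trans (isBigO_of_le _ fun _ => (norm_qPoch_le hq1 _ _).trans (le_abs_self _))
    (isBigO_exp_norm hf _)

lemma isBigO_qPochInf_mul_pow (hq1 : ‖q‖ < 1) (hf : Tendsto f l (𝓝 x)) :
    (fun p : ι × ℕ => qPochInf q (f p.1 * q ^ p.2)) =O[l ×ˢ ⊤] fun _ => (1 : ℝ) := by
  refine .trans (isBigO_of_le _ fun p => ?_) (isBigO_exp_norm hf (1 - ‖q‖)⁻¹)
  calc _ ≤ Real.exp (‖f p.1 * q ^ p.2‖ * (1 - ‖q‖)⁻¹) := norm_qPochInf_le hq1 _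
    _ ≤ Real.exp (‖f p.1‖ * (1 - ‖q‖)⁻¹) :=
        Real.exp_le_exp.2 <| mul_le_mul_of_nonneg_right (norm_mul_pow_le hq1 _ _)
          (inv_nonneg.2 (sub_nonneg.2 hq1.le))
    _ ≤ _ := le_abs_self _

lemma tendsto_qPochInf (hq1 : ‖q‖ < 1) (hf : Tendsto f l (𝓝 x)) :
    Tendsto (fun i => qPochInf q (f i)) l (𝓝 (qPochInf q x)) :=
  ((continuous_qPochInf hq1).tendsto x).comp hf

lemma eventually_qPochInf_ne_zero (hq1 : ‖q‖ < 1) (hf : Tendsto f l (𝓝 x)) (hx : QRegular q x) :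
    ∀ᶠ p : ι × ℕ in l ×ˢ ⊤, qPochInf q (f p.1) ≠ 0 :=
  ((tendsto_qPochInf hq1 hf).eventually_ne (hx.qPochInf_ne_zero hq1)).prod_inl ⊤

lemma isBigO_inv_qPochInf (hq1 : ‖q‖ < 1) (hf : Tendsto f l (𝓝 x)) (hx : QRegular q x) :
    (fun p : ι × ℕ => (qPochInf q (f p.1))⁻¹) =O[l ×ˢ ⊤] fun _ => (1 : ℝ) :=
  isBigO_comp_fst ((tendsto_qPochInf hq1 hf).inv₀ (hx.qPochInf_ne_zero hq1))

lemma isBigO_inv_qPoch (hq1 : ‖q‖ < 1) (hf : Tendsto f l (𝓝 x)) (hx : QRegular q x) :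
    (fun p : ι × ℕ => (qPoch q (f p.1) p.2)⁻¹) =O[l ×ˢ ⊤] fun _ => (1 : ℝ) := by
  refine ((isBigO_qPochInf_mul_pow hq1 hf).mul (isBigO_inv_qPochInf hq1 hf hx)).congr' ?_
    (.of_eq (funext fun _ => one_mul 1))
  filter_upwards [eventually_qPochInf_ne_zero hq1 hf hx] with p hp
  rw [qPochInf_eq_qPoch_mul hq1 (f p.1) p.2] at hp ⊢
  rw [mul_inv, mul_left_comm, mul_inv_cancel₀ (right_ne_zero_of_mul hp), mul_one]

lemma isBigO_inv_qPochInf_mul_pow (hq1 : ‖q‖ < 1) (hf : Tendsto f l (𝓝 x)) (hx : QRegular q x) :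
    (fun p : ι × ℕ => (qPochInf q (f p.1 * q ^ p.2))⁻¹) =O[l ×ˢ ⊤] fun _ => (1 : ℝ) := by
  refine ((isBigO_qPoch hq1 hf).mul (isBigO_inv_qPochInf hq1 hf hx)).congr' ?_
    (.of_eq (funext fun _ => one_mul 1))
  filter_upwards [eventually_qPochInf_ne_zero hq1 hf hx] with p hp
  rw [qPochInf_eq_qPoch_mul hq1 (f p.1) p.2] at hp ⊢
  rw [mul_inv, ← mul_assoc, mul_inv_cancel₀ (left_ne_zero_of_mul hp), one_mul]

lemma isBigO_pow_of_isBigO_one {F : ι × ℕ → ℂ} (hF : F =O[l ×ˢ ⊤] fun _ => (1 : ℝ)) (q : ℂ) :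
    (fun p : ι × ℕ => F p * q ^ p.2) =O[l ×ˢ ⊤] fun p => q ^ p.2 :=
  isBigO_norm_right.1 <| (hF.mul (isBigO_refl (fun p : ι × ℕ => q ^ p.2) _).norm_right).congr_right
    fun _ => one_mul _

lemma exists_norm_le_mul_pow_of_isBigO {F : ι → ℕ → ℂ}
    (hF : (fun p : ι × ℕ => F p.1 p.2) =O[l ×ˢ ⊤] fun p => q ^ p.2) :
    ∃ C, ∀ᶠ i in l, ∀ k, ‖F i k‖ ≤ C * ‖q‖ ^ k := by
  obtain ⟨C, hC⟩ := hF.bound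
  rw [prod_top, eventually_comap] at hC
  exact ⟨C, hC.mono fun i hi k => (hi (i, k) rfl).trans_eq (by rw [norm_pow])⟩

lemma summable_const_mul_geometric (hq1 : ‖q‖ < 1) (C : ℝ) : Summable fun k => C * ‖q‖ ^ k :=
  (summable_geometric_of_lt_one (norm_nonneg q) hq1).mul_left C

lemma summable_of_isBigO_pow [TopologicalSpace ι] {i₀ : ι} {F : ι → ℕ → ℂ} (hq1 : ‖q‖ < 1)
    (hF : (fun p : ι × ℕ => F p.1 p.2) =O[𝓝 i₀ ×ˢ ⊤] fun p => q ^ p.2) : Summable (F i₀) := by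
  obtain ⟨C, hC⟩ := exists_norm_le_mul_pow_of_isBigO hF
  exact (summable_const_mul_geometric hq1 C).of_norm_bounded hC.self_of_nhds

lemma tendsto_tsum_of_isBigO_pow {F : ι → ℕ → ℂ} {G : ℕ → ℂ} (hq1 : ‖q‖ < 1)
    (hF : (fun p : ι × ℕ => F p.1 p.2) =O[l ×ˢ ⊤] fun p => q ^ p.2)
    (hlim : ∀ k, Tendsto (fun i => F i k) l (𝓝 (G k))) :
    Tendsto (fun i => ∑' k, F i k) l (𝓝 (∑' k, G k)) := by
  obtain ⟨C, hC⟩ := exists_norm_le_mul_pow_of_isBigO hF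
  exact tendsto_tsum_of_dominated_convergence (summable_const_mul_geometric hq1 C) hlim hC

lemma tendstoUniformlyOn_sum_range_of_isBigO_pow [TopologicalSpace ι] {L : Set ι}
    {F : ι → ℕ → ℂ} (hq1 : ‖q‖ < 1) (hL : IsCompact L)
    (hF : ∀ i ∈ L, (fun p : ι × ℕ => F p.1 p.2) =O[𝓝 i ×ˢ ⊤] fun p => q ^ p.2) :
    TendstoUniformlyOn (fun n i => ∑ k ∈ Finset.range n, F i k) (fun i => ∑' k, F i k) atTop L := by
  rw [← tendstoLocallyUniformlyOn_iff_tendstoUniformlyOn_of_compact hL,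
    tendstoLocallyUniformlyOn_iff_filter]
  intro i hi
  obtain ⟨C, hC⟩ := exists_norm_le_mul_pow_of_isBigO (hF i hi)
  exact (tendstoUniformlyOn_iff_tendstoUniformlyOnFilter.1 <| tendstoUniformlyOn_tsum_nat
    (s := {y | ∀ k, ‖F y k‖ ≤ C * ‖q‖ ^ k}) (summable_const_mul_geometric hq1 C)
    fun k _ hy => hy k).mono_right
    (le_principal_iff.2 (mem_nhdsWithin_of_mem_nhds hC))

end Bounds

section Contiguity

variable {q b β u v w z : ℂ}

/-- The `k`th coefficient of the two-basis expansion without its factor `q ^ k`, in the symmetric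
parameters `b`, `β = c / de`, `u = c / d`, `v = c / e`. It is normalized to stay defined at `u = 0`
and `v = 0`; interchanging `b` and `β` interchanges the two bases. -/
noncomputable def wpCoeff (q b β u v : ℂ) (k : ℕ) : ℂ :=
  qPochInf q (u * b * q ^ k) * qPochInf q (v * b * q ^ k) * qPochInf q (u / b) *
      qPochInf q (v / b) * (1 - u * v * (b / β) / q * q ^ (2 * k)) *
      (qPoch q (u / β) k * qPoch q (v / β) k * qPoch q (u * v / q) k) /
    (qPochInf q (u * v * (b / β) / q * q ^ k) * qPochInf q (β / b) *
      (qPoch q q k * qPoch q (b / β * q) k))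

/-- The well-poised monomial `Φ_k(z; b, c)`, cleared of denominators by `(cz, c/z; q)_∞`. -/
noncomputable def wpMonomial (q b c z : ℂ) (k : ℕ) : ℂ :=
  qPoch q (b * z) k * qPoch q (b / z) k * (qPochInf q (c * z * q ^ k) * qPochInf q (c / z * q ^ k))

/-- The parameters `b`, `β` and the product `w = uv` for which every `wpCoeff q b β u v k` and
`wpCoeff q β b u v k` has a nonvanishing denominator. -/
structure WPRegular (q b β w : ℂ) : Prop where
  b_ne : b ≠ 0
  β_ne : β ≠ 0
  div_right : QRegular q (b / β)
  div_left : QRegular q (β / b)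
  mul_div_right : QRegular q (w * (b / β) / q)
  mul_div_left : QRegular q (w * (β / b) / q)

namespace WPRegular

lemma symm (h : WPRegular q b β w) : WPRegular q β b w :=
  ⟨h.β_ne, h.b_ne, h.div_left, h.div_right, h.mul_div_left, h.mul_div_right⟩

lemma zero (h : WPRegular q b β w) : WPRegular q b β 0 where
  __ := h
  mul_div_right := by simpa only [zero_mul, zero_div] using qRegular_zero q
  mul_div_left := by simpa only [zero_mul, zero_div] using qRegular_zero q

lemma mul_pow (h : WPRegular q b β w) (n : ℕ) : WPRegular q b β (w * q ^ n) where
  __ := h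
  mul_div_right := by
    convert h.mul_div_right.mul_pow n using 1
    ring
  mul_div_left := by
    convert h.mul_div_left.mul_pow n using 1
    ring

lemma one_sub_ne_zero (hq0 : q ≠ 0) (h : WPRegular q b β w) (k : ℕ) :
    1 - w * (b / β) * q ^ k ≠ 0 := by
  convert h.mul_div_right.one_sub_mul_pow_ne_zero (k + 1) using 1
  rw [pow_succ']
  field_simp

end WPRegular

lemma wpCoeff_comm (q b β u v : ℂ) (k : ℕ) : wpCoeff q b β u v k = wpCoeff q b β v u k := by
  simp only [wpCoeff, mul_comm v u]
  ring

/-- The weight of the monomial of index `k + 1` when `(1 - vz)(1 - v/z)` multiplies the monomial of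
index `k`, as in `mul_wpMonomial`. -/
noncomputable def shiftUp (q b β u v : ℂ) (k : ℕ) : ℂ :=
  (1 - v * (u * v / β) * q ^ k) * (v / b * (1 - u / β * q ^ k)) /
    (1 - u * v * (b / β) * q ^ (2 * k))

/-- The weight of the monomial of index `k` when `(1 - vz)(1 - v/z)` multiplies the monomial of
index `k`, as in `mul_wpMonomial`. -/
noncomputable def shiftSame (q b β u v : ℂ) (k : ℕ) : ℂ :=
  (1 - v * b * q ^ k) * (q ^ k - v / b) / (1 - u * v * (b / β) * q ^ (2 * k))

lemma qPochInf_mul_pow (hq1 : ‖q‖ < 1) (x : ℂ) (k : ℕ) :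
    qPochInf q (x * q ^ k) = (1 - x * q ^ k) * qPochInf q (x * q ^ (k + 1)) := by
  rw [qPochInf_eq_one_sub_mul hq1, pow_succ, mul_assoc]

lemma quadratic_eq_shiftUp_add_shiftSame (hq0 : q ≠ 0) (hz : z ≠ 0)
    (h : WPRegular q b β (u * v)) (k : ℕ) :
    q ^ k * ((1 - u * v / (b * β)) * ((1 - v * z) * (1 - v / z))) =
      shiftUp q b β u v k * ((1 - b * z * q ^ k) * (1 - b / z * q ^ k)) +
        shiftSame q b β u v k *
          ((1 - u * v / β * z * q ^ k) * (1 - u * v / β / z * q ^ k)) := by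
  have hb := h.b_ne
  have hβ := h.β_ne
  have hD := h.one_sub_ne_zero hq0 (2 * k)
  rw [shiftUp, shiftSame, div_mul_eq_mul_div (_ * (_ * (_ - _))), div_mul_eq_mul_div (_ * (_ - _)),
    ← add_div, eq_div_iff hD, pow_mul' q 2 k]
  field_simp
  ring

lemma mul_wpMonomial (hq0 : q ≠ 0) (hq1 : ‖q‖ < 1) (hz : z ≠ 0) (h : WPRegular q b β (u * v))
    (k : ℕ) :
    q ^ k * ((1 - u * v / (b * β)) * ((1 - v * z) * (1 - v / z)) *
        wpMonomial q b (u * (v * q) / β) z k) =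
      shiftUp q b β u v k * wpMonomial q b (u * v / β) z (k + 1) +
        shiftSame q b β u v k * wpMonomial q b (u * v / β) z k := by
  have hmul : u * (v * q) / β * z * q ^ k = u * v / β * z * q ^ (k + 1) := by ring
  have hdiv : u * (v * q) / β / z * q ^ k = u * v / β / z * q ^ (k + 1) := by ring
  simp only [wpMonomial, qPoch_succ, hmul, hdiv, qPochInf_mul_pow hq1 _ k]
  linear_combination (qPoch q (b * z) k * qPoch q (b / z) k *
    (qPochInf q (u * v / β * z * q ^ (k + 1)) * qPochInf q (u * v / β / z * q ^ (k + 1)))) *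
    quadratic_eq_shiftUp_add_shiftSame hq0 hz h k

/-- The common factor of `wpCoeff q b β u v k` and `wpCoeff q b β u v (k + 1)`. -/
noncomputable def wpCoeffCore (q b β u v : ℂ) (k : ℕ) : ℂ :=
  qPochInf q (u * b * q ^ (k + 1)) * qPochInf q (v * b * q ^ (k + 1)) * qPochInf q (u / b) *
      qPochInf q (v / b) * (qPoch q (u / β) k * qPoch q (v / β) k * qPoch q (u * v / q) k) /
    (qPochInf q (u * v * (b / β) / q * q ^ (k + 1)) * qPochInf q (β / b) *
      (qPoch q q k * qPoch q (b / β * q) k))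

lemma wpCoeff_eq_wpCoeffCore_mul (hq1 : ‖q‖ < 1) (b β u v : ℂ) (k : ℕ) :
    wpCoeff q b β u v k = wpCoeffCore q b β u v k *
      ((1 - u * b * q ^ k) * (1 - v * b * q ^ k) * (1 - u * v * (b / β) / q * q ^ (2 * k)) /
        (1 - u * v * (b / β) / q * q ^ k)) := by
  rw [wpCoeff, wpCoeffCore, div_mul_div_comm, qPochInf_mul_pow hq1 (u * b),
    qPochInf_mul_pow hq1 (v * b), qPochInf_mul_pow hq1 (u * v * (b / β) / q)]
  congr 1 <;> ring

lemma wpCoeff_succ_eq_wpCoeffCore_mul (q b β u v : ℂ) (k : ℕ) :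
    wpCoeff q b β u v (k + 1) = wpCoeffCore q b β u v k *
      ((1 - u * v * (b / β) / q * q ^ (2 * (k + 1))) *
        ((1 - u / β * q ^ k) * (1 - v / β * q ^ k) * (1 - u * v / q * q ^ k)) /
        ((1 - q * q ^ k) * (1 - b / β * q * q ^ k))) := by
  simp only [wpCoeff, wpCoeffCore, div_mul_div_comm, qPoch_succ]
  congr 1 <;> ring

lemma wpCoeffCore_mul_q (hq0 : q ≠ 0) (hq1 : ‖q‖ < 1) (b β u v : ℂ) (k : ℕ) :
    wpCoeffCore q b β u v k * ((1 - v / β * q ^ k) * (1 - u * v / q * q ^ k)) =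
      wpCoeffCore q b β u (v * q) k *
        ((1 - v * b * q ^ (k + 1)) * (1 - v / b) * ((1 - v / β) * (1 - u * v / q)) /
          (1 - u * v * (b / β) * q ^ k)) := by
  have hvb : qPochInf q (v * b * q ^ (k + 1)) =
      (1 - v * b * q ^ (k + 1)) * qPochInf q (v * q * b * q ^ (k + 1)) := by
    rw [qPochInf_mul_pow hq1]
    ring_nf
  have hv : qPochInf q (v / b) = (1 - v / b) * qPochInf q (v * q / b) := by
    rw [qPochInf_eq_one_sub_mul hq1, div_mul_eq_mul_div]
  have hden : qPochInf q (u * v * (b / β) / q * q ^ (k + 1)) = (1 - u * v * (b / β) * q ^ k) *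
      qPochInf q (u * (v * q) * (b / β) / q * q ^ (k + 1)) := by
    have harg : u * v * (b / β) / q * q ^ (k + 1) = u * v * (b / β) * q ^ k := by
      rw [pow_succ']
      field_simp
    rw [harg, qPochInf_eq_one_sub_mul hq1, ← harg]
    ring_nf
  have hvβ : qPoch q (v / β) k * (1 - v / β * q ^ k) = (1 - v / β) * qPoch q (v * q / β) k := by
    rw [← qPoch_succ, qPoch_succ', div_mul_eq_mul_div]
  have huv : qPoch q (u * v / q) k * (1 - u * v / q * q ^ k) =
      (1 - u * v / q) * qPoch q (u * (v * q) / q) k := by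
    rw [← qPoch_succ, qPoch_succ', div_mul_eq_mul_div, mul_assoc u]
  rw [wpCoeffCore, wpCoeffCore, div_mul_div_comm, div_mul_eq_mul_div, hvb, hv, hden]
  congr 1
  · linear_combination (qPochInf q (u * b * q ^ (k + 1)) * ((1 - v * b * q ^ (k + 1)) *
      qPochInf q (v * q * b * q ^ (k + 1))) * qPochInf q (u / b) *
      ((1 - v / b) * qPochInf q (v * q / b)) * qPoch q (u / β) k) *
      (hvβ * (qPoch q (u * v / q) k * (1 - u * v / q * q ^ k)) +
        (1 - v / β) * qPoch q (v * q / β) k * huv)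
  · ring

lemma wpCoeff_zero (hq0 : q ≠ 0) (hq1 : ‖q‖ < 1) (h : WPRegular q b β (u * v)) :
    wpCoeff q b β u v 0 = qPochInf q (u * b) * qPochInf q (v * b) * qPochInf q (u / b) *
      qPochInf q (v / b) / (qPochInf q (u * v * (b / β)) * qPochInf q (β / b)) := by
  have hden : qPochInf q (u * v * (b / β) / q) =
      (1 - u * v * (b / β) / q) * qPochInf q (u * v * (b / β)) := by
    rw [qPochInf_eq_one_sub_mul hq1, div_mul_cancel₀ _ hq0]
  simp only [wpCoeff, qPoch_zero, mul_zero, pow_zero, mul_one, hden]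
  rw [mul_comm (1 - _), mul_right_comm _ (1 - _),
    mul_div_mul_right _ _ h.mul_div_right.one_sub_ne_zero]

lemma wpCoeff_shift_zero (hq0 : q ≠ 0) (hq1 : ‖q‖ < 1) (h : WPRegular q b β (u * v)) :
    wpCoeff q b β u v 0 = shiftSame q b β u v 0 * wpCoeff q b β u (v * q) 0 := by
  have h' : WPRegular q b β (u * (v * q)) := by
    simpa only [pow_one, mul_assoc] using h.mul_pow 1
  rw [wpCoeff_zero hq0 hq1 h, wpCoeff_zero hq0 hq1 h', shiftSame, div_mul_div_comm,
    qPochInf_eq_one_sub_mul hq1 (v * b), qPochInf_eq_one_sub_mul hq1 (v / b),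
    qPochInf_eq_one_sub_mul hq1 (u * v * (b / β)), div_mul_eq_mul_div v]
  congr 1 <;> ring_nf

lemma div_mul_pow_two_mul_succ (hq0 : q ≠ 0) (y : ℂ) (k : ℕ) :
    y / q * q ^ (2 * (k + 1)) = y * (q * (q ^ k) ^ 2) := by
  rw [div_mul_eq_mul_div, div_eq_iff hq0]
  ring

lemma wpCoeff_succ_eq (hq0 : q ≠ 0) (hq1 : ‖q‖ < 1) (b β u v : ℂ) (k : ℕ) :
    wpCoeff q b β u v (k + 1) = wpCoeffCore q b β u (v * q) k *
      ((1 - v * b * q ^ (k + 1)) * (1 - u / β * q ^ k)) *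
        ((1 - v / b) * (1 - v / β) * (1 - u * v / q) *
          (1 - u * v * (b / β) * (q * (q ^ k) ^ 2))) /
        ((1 - u * v * (b / β) * q ^ k) * ((1 - q * q ^ k) * (1 - b / β * q * q ^ k))) := by
  rw [wpCoeff_succ_eq_wpCoeffCore_mul, div_mul_pow_two_mul_succ hq0]
  simp only [mul_div_assoc, mul_assoc, ← div_div]
  linear_combination ((1 - u * v * (b / β) * (q * (q ^ k) ^ 2)) * (1 - u / β * q ^ k) /
    (1 - q * q ^ k) / (1 - b / β * q * q ^ k)) * wpCoeffCore_mul_q hq0 hq1 b β u v k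

lemma shiftUp_mul_wpCoeff (hq0 : q ≠ 0) (hq1 : ‖q‖ < 1) (h : WPRegular q b β (u * v)) (k : ℕ) :
    shiftUp q b β u v k * wpCoeff q b β u (v * q) k = wpCoeffCore q b β u (v * q) k *
      ((1 - v * b * q ^ (k + 1)) * (1 - u / β * q ^ k)) *
        (v / b * ((1 - v * (u * v / β) * q ^ k) * (1 - u * b * q ^ k))) /
        (1 - u * v * (b / β) * q ^ k) := by
  have hdiv : ∀ n, u * (v * q) * (b / β) / q * q ^ n = u * v * (b / β) * q ^ n := fun n => by
    field_simp
  rw [wpCoeff_eq_wpCoeffCore_mul hq1, shiftUp, hdiv, hdiv]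
  have hcancel := div_self (h.one_sub_ne_zero hq0 (2 * k))
  linear_combination (wpCoeffCore q b β u (v * q) k *
    ((1 - v * b * q ^ (k + 1)) * (1 - u / β * q ^ k)) *
    (v / b * ((1 - v * (u * v / β) * q ^ k) * (1 - u * b * q ^ k))) /
    (1 - u * v * (b / β) * q ^ k)) * hcancel

lemma shiftSame_mul_wpCoeff_succ (hq0 : q ≠ 0) (h : WPRegular q b β (u * v)) (k : ℕ) :
    shiftSame q b β u v (k + 1) * wpCoeff q b β u (v * q) (k + 1) =
      wpCoeffCore q b β u (v * q) k * ((1 - v * b * q ^ (k + 1)) * (1 - u / β * q ^ k)) *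
        ((q * q ^ k - v / b) * ((1 - v * q / β * q ^ k) * (1 - u * v * q ^ k))) /
        ((1 - q * q ^ k) * (1 - b / β * q * q ^ k)) := by
  have hdiv : u * (v * q) / q = u * v := by
    field_simp
  have hdiv' : u * (v * q) * (b / β) / q = u * v * (b / β) := by
    field_simp
  rw [wpCoeff_succ_eq_wpCoeffCore_mul, shiftSame, hdiv, hdiv']
  have hcancel := div_self (h.one_sub_ne_zero hq0 (2 * (k + 1)))
  linear_combination (wpCoeffCore q b β u (v * q) k *
    ((1 - v * b * q ^ (k + 1)) * (1 - u / β * q ^ k)) *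
    ((q * q ^ k - v / b) * ((1 - v * q / β * q ^ k) * (1 - u * v * q ^ k))) /
    ((1 - q * q ^ k) * (1 - b / β * q * q ^ k))) * hcancel

/-- The rational identity behind `wpCoeff_shift_succ`, at `x = q ^ k`. -/
lemma shift_identity (hq0 : q ≠ 0) (hb : b ≠ 0) (hβ : β ≠ 0) (u v x : ℂ) :
    q * x * ((1 - v / b) * (1 - v / β) * (1 - u * v / q) * (1 - u * v * (b / β) * (q * x ^ 2))) =
      v / b * ((1 - v * (u * v / β) * x) * (1 - u * b * x) * (1 - q * x) * (1 - b / β * q * x)) +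
        (q * x - v / b) *
          ((1 - v * q / β * x) * (1 - u * v * x) * (1 - u * v * (b / β) * x)) := by
  field_simp
  ring

lemma wpCoeff_shift_succ (hq0 : q ≠ 0) (hq1 : ‖q‖ < 1) (h : WPRegular q b β (u * v)) (k : ℕ) :
    wpCoeff q b β u v (k + 1) * q ^ (k + 1) =
      shiftUp q b β u v k * wpCoeff q b β u (v * q) k +
        shiftSame q b β u v (k + 1) * wpCoeff q b β u (v * q) (k + 1) := by
  have h₁ : 1 - u * v * (b / β) * q ^ k ≠ 0 := h.one_sub_ne_zero hq0 k
  have h₂ : 1 - q * q ^ k ≠ 0 := (qRegular_self hq1).one_sub_mul_pow_ne_zero k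
  have h₃ : 1 - b / β * q * q ^ k ≠ 0 := h.div_right.mul_q.one_sub_mul_pow_ne_zero k
  rw [wpCoeff_succ_eq hq0 hq1, shiftUp_mul_wpCoeff hq0 hq1 h, shiftSame_mul_wpCoeff_succ hq0 h,
    div_add_div _ _ h₁ (mul_ne_zero h₂ h₃), div_mul_eq_mul_div]
  congr 1
  linear_combination (wpCoeffCore q b β u (v * q) k *
    ((1 - v * b * q ^ (k + 1)) * (1 - u / β * q ^ k))) *
    shift_identity hq0 h.b_ne h.β_ne u v (q ^ k)

end Contiguity

section Summation

variable {q b β u v w z : ℂ} {ι : Type*} {l : Filter ι} {U V Z : ι → ℂ}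

lemma isBigO_wpCoeff (hq1 : ‖q‖ < 1) (h : WPRegular q b β (u * v)) (hU : Tendsto U l (𝓝 u))
    (hV : Tendsto V l (𝓝 v)) :
    (fun p : ι × ℕ => wpCoeff q b β (U p.1) (V p.1) p.2) =O[l ×ˢ ⊤] fun _ => (1 : ℝ) := by
  have hUV := hU.mul hV
  have hM := (hUV.mul_const (b / β)).div_const q
  have hnum := isBigO_one_mul (isBigO_one_mul (isBigO_one_mul (isBigO_one_mul (isBigO_one_mul
    (isBigO_qPochInf_mul_pow hq1 (hU.mul_const b)) (isBigO_qPochInf_mul_pow hq1 (hV.mul_const b)))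
    (isBigO_comp_fst (tendsto_qPochInf hq1 (hU.div_const b))))
    (isBigO_comp_fst (tendsto_qPochInf hq1 (hV.div_const b))))
    ((isBigO_const_const (1 : ℂ) one_ne_zero _).sub (isBigO_mul_pow hq1 hM fun k => 2 * k)))
    (isBigO_one_mul (isBigO_one_mul (isBigO_qPoch hq1 (hU.div_const β))
      (isBigO_qPoch hq1 (hV.div_const β))) (isBigO_qPoch hq1 (hUV.div_const q)))
  have hden := isBigO_one_mul (isBigO_one_mul (isBigO_inv_qPochInf_mul_pow hq1 hM h.mul_div_right)
    (isBigO_const_const (qPochInf q (β / b))⁻¹ one_ne_zero _))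
    (isBigO_one_mul (isBigO_inv_qPoch hq1 tendsto_const_nhds (qRegular_self hq1))
      (isBigO_inv_qPoch hq1 tendsto_const_nhds h.div_right.mul_q))
  refine (isBigO_one_mul hnum hden).congr_left fun p => ?_
  rw [wpCoeff, div_eq_mul_inv _ (_ * _ * (_ * _)), mul_inv, mul_inv, mul_inv]

lemma isBigO_wpMonomial (hq1 : ‖q‖ < 1) (hz : z ≠ 0) (hV : Tendsto V l (𝓝 v))
    (hZ : Tendsto Z l (𝓝 z)) (b : ℂ) :
    (fun p : ι × ℕ => wpMonomial q b (V p.1) (Z p.1) p.2) =O[l ×ˢ ⊤] fun _ => (1 : ℝ) :=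
  (isBigO_one_mul (isBigO_one_mul (isBigO_qPoch hq1 (hZ.const_mul b))
    (isBigO_qPoch hq1 (tendsto_const_nhds.div hZ hz)))
    (isBigO_one_mul (isBigO_qPochInf_mul_pow hq1 (hV.mul hZ))
      (isBigO_qPochInf_mul_pow hq1 (hV.div hZ hz)))).congr_left fun _ => rfl

lemma isBigO_wpCoeff_mul_wpMonomial (hq1 : ‖q‖ < 1) (hz : z ≠ 0) (h : WPRegular q b β (u * v))
    (hU : Tendsto U l (𝓝 u)) (hV : Tendsto V l (𝓝 v)) (hZ : Tendsto Z l (𝓝 z)) :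
    (fun p : ι × ℕ => wpCoeff q b β (U p.1) (V p.1) p.2 *
      wpMonomial q b (U p.1 * V p.1 / β) (Z p.1) p.2 * q ^ p.2) =O[l ×ˢ ⊤] fun p => q ^ p.2 :=
  isBigO_pow_of_isBigO_one (isBigO_one_mul (isBigO_wpCoeff hq1 h hU hV)
    (isBigO_wpMonomial hq1 hz ((hU.mul hV).div_const β) hZ b)) q

lemma continuousAt_wpCoeff_mul_wpMonomial (hq1 : ‖q‖ < 1) (hz : z ≠ 0)
    (h : WPRegular q b β (u * v)) (k : ℕ) :
    ContinuousAt (fun p : ℂ × ℂ × ℂ => wpCoeff q b β p.1 p.2.1 k *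
      wpMonomial q b (p.1 * p.2.1 / β) p.2.2 k) (u, v, z) := by
  have hden : qPochInf q (u * v * (b / β) / q * q ^ k) * qPochInf q (β / b) *
      (qPoch q q k * qPoch q (b / β * q) k) ≠ 0 :=
    mul_ne_zero (mul_ne_zero ((h.mul_div_right.mul_pow k).qPochInf_ne_zero hq1)
      (h.div_left.qPochInf_ne_zero hq1))
      (mul_ne_zero ((qRegular_self hq1).qPoch_ne_zero k) (h.div_right.mul_q.qPoch_ne_zero k))
  unfold wpCoeff wpMonomial
  fun_prop (disch := assumption)

/-- One side of the two-basis expansion: the series in the monomials of base `b`, multiplied by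
`(βz, β/z; q)_∞` so that no denominator depends on `z`. -/
noncomputable def wpSeries (q b β u v z : ℂ) : ℂ :=
  qPochPair q β z * ∑' k, wpCoeff q b β u v k * wpMonomial q b (u * v / β) z k * q ^ k

/-- The sum of the two sides of the two-basis expansion. -/
noncomputable def wpTotal (q b β u v z : ℂ) : ℂ :=
  wpSeries q b β u v z + wpSeries q β b u v z

lemma wpTotal_comm (q b β u v z : ℂ) : wpTotal q b β u v z = wpTotal q b β v u z := by
  simp only [wpTotal, wpSeries, wpCoeff_comm q _ _ u v, mul_comm u v]

lemma tendsto_wpSeries (hq1 : ‖q‖ < 1) (hz : z ≠ 0) (h : WPRegular q b β (u * v))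
    (hU : Tendsto U l (𝓝 u)) (hV : Tendsto V l (𝓝 v)) (hZ : Tendsto Z l (𝓝 z)) :
    Tendsto (fun i => wpSeries q b β (U i) (V i) (Z i)) l (𝓝 (wpSeries q b β u v z)) := by
  have hterm : ∀ k, Tendsto (fun i => wpCoeff q b β (U i) (V i) k *
      wpMonomial q b (U i * V i / β) (Z i) k) l
      (𝓝 (wpCoeff q b β u v k * wpMonomial q b (u * v / β) z k)) := fun k => by
    have hcont := (continuousAt_wpCoeff_mul_wpMonomial hq1 hz h k).tendsto
    simpa only [Function.comp_def] using hcont.comp (hU.prodMk_nhds (hV.prodMk_nhds hZ))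
  have hsum := tendsto_tsum_of_isBigO_pow (F := fun i k =>
      wpCoeff q b β (U i) (V i) k * wpMonomial q b (U i * V i / β) (Z i) k * q ^ k)
    hq1 (isBigO_wpCoeff_mul_wpMonomial hq1 hz h hU hV hZ) fun k => (hterm k).mul_const (q ^ k)
  exact ((continuousAt_qPochPair hq1 β hz).tendsto.comp hZ).mul hsum

lemma tendsto_wpTotal (hq1 : ‖q‖ < 1) (hz : z ≠ 0) (h : WPRegular q b β (u * v))
    (hU : Tendsto U l (𝓝 u)) (hV : Tendsto V l (𝓝 v)) (hZ : Tendsto Z l (𝓝 z)) :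
    Tendsto (fun i => wpTotal q b β (U i) (V i) (Z i)) l (𝓝 (wpTotal q b β u v z)) :=
  (tendsto_wpSeries hq1 hz h hU hV hZ).add (tendsto_wpSeries hq1 hz h.symm hU hV hZ)

lemma summable_wpCoeff_mul_wpMonomial (hq1 : ‖q‖ < 1) (hz : z ≠ 0)
    (h : WPRegular q b β (u * v)) :
    Summable fun k => wpCoeff q b β u v k * wpMonomial q b (u * v / β) z k * q ^ k := by
  have hbound := isBigO_wpCoeff_mul_wpMonomial (Z := id) hq1 hz h tendsto_const_nhds
    tendsto_const_nhds tendsto_id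
  exact summable_of_isBigO_pow (i₀ := z)
    (F := fun z k => wpCoeff q b β u v k * wpMonomial q b (u * v / β) z k * q ^ k) hq1 hbound

lemma sum_wpCoeff_mul_wpMonomial_shift (hq0 : q ≠ 0) (hq1 : ‖q‖ < 1) (hz : z ≠ 0)
    (h : WPRegular q b β (u * v)) (n : ℕ) :
    (1 - u * v / (b * β)) * ((1 - v * z) * (1 - v / z)) * ∑ k ∈ Finset.range (n + 1),
        wpCoeff q b β u (v * q) k * wpMonomial q b (u * (v * q) / β) z k * q ^ k =
      ∑ k ∈ Finset.range (n + 1), wpCoeff q b β u v k * wpMonomial q b (u * v / β) z k * q ^ k +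
        shiftUp q b β u v n * wpCoeff q b β u (v * q) n *
          wpMonomial q b (u * v / β) z (n + 1) := by
  induction n with
  | zero =>
    have hmul := mul_wpMonomial hq0 hq1 hz h 0
    simp only [zero_add, Finset.sum_range_one, wpCoeff_shift_zero hq0 hq1 h]
    linear_combination wpCoeff q b β u (v * q) 0 * hmul
  | succ n ih =>
    have hmul := mul_wpMonomial hq0 hq1 hz h (n + 1)
    have hcoeff := wpCoeff_shift_succ hq0 hq1 h n
    rw [Finset.sum_range_succ, Finset.sum_range_succ _ (n + 1)]
    linear_combination ih + wpCoeff q b β u (v * q) (n + 1) * hmul -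
      wpMonomial q b (u * v / β) z (n + 1) * hcoeff

lemma tendsto_mul_pow (hq1 : ‖q‖ < 1) (x : ℂ) : Tendsto (fun n => x * q ^ n) atTop (𝓝 0) := by
  simpa only [mul_zero] using (tendsto_pow_atTop_nhds_zero_of_norm_lt_one hq1).const_mul x

lemma tendsto_mul_pow_two_mul (hq1 : ‖q‖ < 1) (x : ℂ) :
    Tendsto (fun n => x * q ^ (2 * n)) atTop (𝓝 0) :=
  (tendsto_mul_pow hq1 x).comp (tendsto_id.const_mul_atTop' two_pos)

lemma tendsto_qPochInf_mul_pow (hq1 : ‖q‖ < 1) (x : ℂ) :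
    Tendsto (fun n => qPochInf q (x * q ^ n)) atTop (𝓝 1) := by
  simpa only [qPochInf_zero] using tendsto_qPochInf hq1 (tendsto_mul_pow hq1 x)

lemma tendsto_shiftUp (hq1 : ‖q‖ < 1) (b β u v : ℂ) :
    Tendsto (fun n => shiftUp q b β u v n) atTop (𝓝 (v / b)) := by
  have hone : ∀ x, Tendsto (fun n => 1 - x * q ^ n) atTop (𝓝 1) := fun x => by
    simpa only [sub_zero] using (tendsto_mul_pow hq1 x).const_sub 1
  have hden : Tendsto (fun n => 1 - u * v * (b / β) * q ^ (2 * n)) atTop (𝓝 1) := by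
    simpa only [sub_zero] using (tendsto_mul_pow_two_mul hq1 (u * v * (b / β))).const_sub 1
  simpa only [shiftUp, Pi.div_def, one_mul, mul_one, div_one] using
    ((hone (v * (u * v / β))).mul ((hone (u / β)).const_mul (v / b))).div hden one_ne_zero

lemma tendsto_wpCoeff (hq1 : ‖q‖ < 1) (hbβ : QRegular q (b / β)) (hβb : QRegular q (β / b))
    (u v : ℂ) :
    Tendsto (fun n => wpCoeff q b β u v n) atTop (𝓝 (qPochInf q (u / b) * qPochInf q (v / b) *
      (qPochInf q (u / β) * qPochInf q (v / β) * qPochInf q (u * v / q)) /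
    (qPochInf q (β / b) * (qPochInf q q * qPochInf q (b / β * q))))) := by
  have hone : Tendsto (fun n => 1 - u * v * (b / β) / q * q ^ (2 * n)) atTop (𝓝 1) := by
    simpa only [sub_zero] using (tendsto_mul_pow_two_mul hq1 (u * v * (b / β) / q)).const_sub 1
  have hnum := (((((tendsto_qPochInf_mul_pow hq1 (u * b)).mul
    (tendsto_qPochInf_mul_pow hq1 (v * b))).mul_const (qPochInf q (u / b))).mul_const
    (qPochInf q (v / b))).mul hone).mul (((tendsto_qPoch hq1 (u / β)).mul
    (tendsto_qPoch hq1 (v / β))).mul (tendsto_qPoch hq1 (u * v / q)))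
  have hden := ((tendsto_qPochInf_mul_pow hq1 (u * v * (b / β) / q)).mul_const
    (qPochInf q (β / b))).mul ((tendsto_qPoch hq1 q).mul (tendsto_qPoch hq1 (b / β * q)))
  have hden₀ : 1 * qPochInf q (β / b) * (qPochInf q q * qPochInf q (b / β * q)) ≠ 0 :=
    mul_ne_zero (mul_ne_zero one_ne_zero (hβb.qPochInf_ne_zero hq1))
      (mul_ne_zero ((qRegular_self hq1).qPochInf_ne_zero hq1) (hbβ.mul_q.qPochInf_ne_zero hq1))
  simpa only [wpCoeff, Pi.div_def, one_mul, mul_one] using hnum.div hden hden₀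

lemma tendsto_wpMonomial (hq1 : ‖q‖ < 1) (b c z : ℂ) :
    Tendsto (fun n => wpMonomial q b c z n) atTop (𝓝 (qPochPair q b z)) := by
  simpa only [wpMonomial, qPochPair, mul_one] using
    ((tendsto_qPoch hq1 (b * z)).mul (tendsto_qPoch hq1 (b / z))).mul
    ((tendsto_qPochInf_mul_pow hq1 (c * z)).mul (tendsto_qPochInf_mul_pow hq1 (c / z)))

/-- The limit of the last term of `sum_wpCoeff_mul_wpMonomial_shift`, times
`(βz, β/z; q)_∞ (b - β) / v`. -/
noncomputable def shiftBoundary (q b β u v z : ℂ) : ℂ :=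
  qPochPair q b z * qPochPair q β z *
      (qPochInf q (u / b) * qPochInf q (v * q / b) * (qPochInf q (u / β) * qPochInf q (v * q / β)) *
        qPochInf q (u * v)) /
    (qPochInf q q * (qPochInf q (b / β * q) * qPochInf q (β / b * q)))

lemma shiftBoundary_comm (q b β u v z : ℂ) :
    shiftBoundary q b β u v z = shiftBoundary q β b u v z := by
  unfold shiftBoundary
  congr 1 <;> ring

lemma tendsto_shiftUp_mul (hq0 : q ≠ 0) (hq1 : ‖q‖ < 1) (h : WPRegular q b β w) (u v z : ℂ) :
    Tendsto (fun n => qPochPair q β z *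
      (shiftUp q b β u v n * wpCoeff q b β u (v * q) n * wpMonomial q b (u * v / β) z (n + 1)))
      atTop (𝓝 (v / (b - β) * shiftBoundary q b β u v z)) := by
  have hlim := (((tendsto_shiftUp hq1 b β u v).mul
    (tendsto_wpCoeff hq1 h.div_right h.div_left u (v * q))).mul
    ((tendsto_add_atTop_iff_nat 1).2 (tendsto_wpMonomial hq1 b (u * v / β) z))).const_mul
    (qPochPair q β z)
  have hdiv : v / (b - β) = v / b * (1 - β / b)⁻¹ := by
    rw [div_mul_eq_mul_div, ← div_eq_mul_inv, div_div, sub_mul, one_mul, div_mul_cancel₀ _ h.b_ne]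
  convert hlim using 2
  rw [hdiv, qPochInf_eq_one_sub_mul hq1 (β / b), shiftBoundary, ← mul_assoc u,
    mul_div_cancel_right₀ _ hq0, div_eq_mul_inv _ (_ * (_ * _)), div_eq_mul_inv _ (_ * _ * _)]
  simp only [mul_inv]
  ring

lemma wpSeries_shift (hq0 : q ≠ 0) (hq1 : ‖q‖ < 1) (hz : z ≠ 0) (h : WPRegular q b β (u * v)) :
    (1 - u * v / (b * β)) * ((1 - v * z) * (1 - v / z)) * wpSeries q b β u (v * q) z =
      wpSeries q b β u v z + v / (b - β) * shiftBoundary q b β u v z := by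
  have h' : WPRegular q b β (u * (v * q)) := by
    simpa only [pow_one, mul_assoc] using h.mul_pow 1
  have hpartial : ∀ {f : ℕ → ℂ}, Summable f → Tendsto (fun n => qPochPair q β z *
      ∑ k ∈ Finset.range (n + 1), f k) atTop (𝓝 (qPochPair q β z * ∑' k, f k)) := fun hf =>
    ((tendsto_add_atTop_iff_nat 1).2 hf.hasSum.tendsto_sum_nat).const_mul _
  have hleft := (hpartial (summable_wpCoeff_mul_wpMonomial hq1 hz h')).const_mul
    ((1 - u * v / (b * β)) * ((1 - v * z) * (1 - v / z)))
  have hright := (hpartial (summable_wpCoeff_mul_wpMonomial hq1 hz h)).add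
    (tendsto_shiftUp_mul hq0 hq1 h u v z)
  refine tendsto_nhds_unique hleft (hright.congr fun n => ?_)
  linear_combination -qPochPair q β z *
    sum_wpCoeff_mul_wpMonomial_shift hq0 hq1 hz h n

lemma wpTotal_shift (hq0 : q ≠ 0) (hq1 : ‖q‖ < 1) (hz : z ≠ 0) (h : WPRegular q b β (u * v)) :
    wpTotal q b β u v z =
      (1 - u * v / (b * β)) * ((1 - v * z) * (1 - v / z)) * wpTotal q b β u (v * q) z := by
  have hb := wpSeries_shift hq0 hq1 hz h
  have hβ := wpSeries_shift hq0 hq1 hz h.symm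
  rw [mul_comm β b, shiftBoundary_comm, ← neg_sub b β, div_neg] at hβ
  rw [wpTotal, wpTotal]
  linear_combination -hb - hβ

lemma wpTotal_shift_pow (hq0 : q ≠ 0) (hq1 : ‖q‖ < 1) (hz : z ≠ 0) (h : WPRegular q b β (u * v))
    (n : ℕ) :
    wpTotal q b β u v z = qPoch q (u * v / (b * β)) n * (qPoch q (v * z) n * qPoch q (v / z) n) *
      wpTotal q b β u (v * q ^ n) z := by
  induction n with
  | zero => simp only [qPoch_zero, pow_zero, mul_one, one_mul]
  | succ n ih =>
    have h' : WPRegular q b β (u * (v * q ^ n)) := by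
      simpa only [mul_assoc] using h.mul_pow n
    rw [ih, wpTotal_shift hq0 hq1 hz h']
    simp only [qPoch_succ, pow_succ]
    ring_nf

lemma wpTotal_eq_mul_zero (hq0 : q ≠ 0) (hq1 : ‖q‖ < 1) (hz : z ≠ 0)
    (h : WPRegular q b β (u * v)) :
    wpTotal q b β u v z =
      qPochInf q (u * v / (b * β)) * qPochPair q v z * wpTotal q b β u 0 z := by
  have h₀ : WPRegular q b β (u * 0) := by
    simpa only [mul_zero] using h.zero
  have hlim := ((tendsto_qPoch hq1 (u * v / (b * β))).mul
    ((tendsto_qPoch hq1 (v * z)).mul (tendsto_qPoch hq1 (v / z)))).mul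
    (tendsto_wpTotal hq1 hz h₀ tendsto_const_nhds (tendsto_mul_pow hq1 v) tendsto_const_nhds)
  exact tendsto_nhds_unique (tendsto_const_nhds.congr (wpTotal_shift_pow hq0 hq1 hz h)) hlim

lemma wpTotal_zero_right (hq0 : q ≠ 0) (hq1 : ‖q‖ < 1) (hz : z ≠ 0) (h : WPRegular q b β w)
    (u : ℂ) :
    wpTotal q b β u 0 z = qPochPair q u z * wpTotal q b β 0 0 z := by
  have h₀ : WPRegular q b β (0 * u) := by
    simpa only [zero_mul] using h.zero
  rw [wpTotal_comm, wpTotal_eq_mul_zero hq0 hq1 hz h₀, zero_mul, zero_div, qPochInf_zero, one_mul]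

lemma wpSeries_self_zero_left (hq1 : ‖q‖ < 1) (hβ : β ≠ 0) (b z : ℂ) :
    wpSeries q β b β 0 z = 0 := by
  simp only [wpSeries, wpCoeff, div_self hβ, qPochInf_one hq1, mul_zero, zero_mul, zero_div,
    tsum_zero]

lemma wpSeries_self_zero_right (hq0 : q ≠ 0) (hq1 : ‖q‖ < 1) (h : WPRegular q b β w) (z : ℂ) :
    wpSeries q b β β 0 z = qPochPair q β z * qPochInf q (b * β) := by
  have h₀ : WPRegular q b β (β * 0) := by
    simpa only [mul_zero] using h.zero
  have hcoeff : wpCoeff q b β β 0 0 = qPochInf q (b * β) := by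
    rw [wpCoeff_zero hq0 hq1 h₀]
    simp only [mul_zero, zero_mul, zero_div, qPochInf_zero, mul_one, one_mul]
    rw [mul_div_cancel_right₀ _ (h.div_left.qPochInf_ne_zero hq1), mul_comm]
  have hsucc : ∀ k ≠ 0, wpCoeff q b β β 0 k * wpMonomial q b (β * 0 / β) z k * q ^ k = 0 := by
    rintro (_ | k) hk
    · exact absurd rfl hk
    · simp only [wpCoeff, div_self h.β_ne, qPoch_one_succ, zero_mul, mul_zero, zero_div]
  rw [wpSeries, tsum_eq_single 0 hsucc, hcoeff]
  simp only [wpMonomial, qPoch_zero, pow_zero, mul_zero, zero_mul, zero_div, qPochInf_zero, mul_one]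

lemma countable_not_qRegular_mul (q x : ℂ) : {z | ¬QRegular q (x * z)}.Countable := by
  refine (Set.countable_range fun m => (x * q ^ m)⁻¹).mono fun z hz => ?_
  simp only [QRegular, Set.mem_ofPred_eq, not_forall, not_not] at hz
  obtain ⟨m, hm⟩ := hz
  exact ⟨m, (eq_inv_of_mul_eq_one_right (by rw [← hm]; ring)).symm⟩

lemma countable_not_qRegular_div (q x : ℂ) : {z | ¬QRegular q (x / z)}.Countable := by
  refine (Set.countable_range fun m => x * q ^ m).mono fun z hz => ?_
  simp only [QRegular, Set.mem_ofPred_eq, not_forall, not_not, div_mul_eq_mul_div] at hz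
  obtain ⟨m, hm⟩ := hz
  exact ⟨m, eq_of_div_eq_one hm⟩

lemma wpTotal_zero_zero (hq0 : q ≠ 0) (hq1 : ‖q‖ < 1) (hz : z ≠ 0) (h : WPRegular q b β w) :
    wpTotal q b β 0 0 z = qPochInf q (b * β) := by
  have h₀ : WPRegular q b β (0 * 0) := by
    simpa only [mul_zero] using h.zero
  have hdense : Dense {y | y = 0 ∨ ¬QRegular q (β * y) ∨ ¬QRegular q (β / y)}ᶜ :=
    Set.Countable.dense_compl ℂ ((Set.countable_singleton 0).union
      ((countable_not_qRegular_mul q β).union (countable_not_qRegular_div q β)))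
  have hfreq : ∃ᶠ y in 𝓝 z, wpTotal q b β 0 0 y ∈ ({qPochInf q (b * β)} : Set ℂ) := by
    refine (mem_closure_iff_frequently.1 (hdense z)).mono fun y hy => ?_
    simp only [Set.mem_compl_iff, Set.mem_ofPred_eq, not_or, not_not] at hy
    obtain ⟨hy₀, hmul, hdiv⟩ := hy
    have hdeg := wpTotal_zero_right hq0 hq1 hy₀ h β
    rw [wpTotal, wpSeries_self_zero_left hq1 h.β_ne, wpSeries_self_zero_right hq0 hq1 h,
      add_zero] at hdeg
    exact (mul_left_cancel₀ (qPochPair_ne_zero hq1 hmul hdiv) hdeg).symm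
  exact isClosed_singleton.mem_of_frequently_of_tendsto hfreq
    (tendsto_wpTotal hq1 hz h₀ tendsto_const_nhds tendsto_const_nhds tendsto_id)

theorem wpTotal_eq (hq0 : q ≠ 0) (hq1 : ‖q‖ < 1) (hz : z ≠ 0) (h : WPRegular q b β (u * v)) :
    wpTotal q b β u v z = qPochPair q u z * qPochPair q v z *
        (qPochInf q (u * v / (b * β)) * qPochInf q (b * β)) := by
  rw [wpTotal_eq_mul_zero hq0 hq1 hz h, wpTotal_zero_right hq0 hq1 hz h,
    wpTotal_zero_zero hq0 hq1 hz h]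
  ring

end Summation

section Taylor

variable {q s b c d e x z κ : ℂ} {F G : ℂ → ℂ}

lemma kernH_eq_qPochPair (q c d e z : ℂ) :
    kernH q c d e z = qPochPair q (c / d) z * qPochPair q (c / e) z /
      (qPochPair q c z * qPochPair q (c / (d * e)) z) := by
  simp only [kernH, qPochPair, ← div_div _ _ z, mul_div_right_comm _ z]
  ring

lemma qPochPair_mul_left (hs0 : s ≠ 0) (hs1 : ‖s ^ 2‖ < 1) (x z : ℂ) :
    qPochPair (s ^ 2) x (s * z) = (1 - x / s / z) * qPochPair (s ^ 2) (x * s) z := by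
  have hshift : x / s / z * s ^ 2 = x * s / z := by field_simp
  rw [qPochPair, qPochPair, ← div_div, qPochInf_eq_one_sub_mul hs1 (x / s / z), hshift]
  ring_nf

lemma qPochPair_inv_mul_left (hs0 : s ≠ 0) (hs1 : ‖s ^ 2‖ < 1) (x z : ℂ) :
    qPochPair (s ^ 2) x (s⁻¹ * z) = (1 - x / s * z) * qPochPair (s ^ 2) (x * s) z := by
  have hshift : x / s * z * s ^ 2 = x * s * z := by field_simp
  rw [qPochPair, qPochPair, ← mul_assoc, ← div_eq_mul_inv,
    qPochInf_eq_one_sub_mul hs1 (x / s * z), hshift, ← div_div, div_inv_eq_mul, mul_assoc]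

/-- No factor of the denominator of `H(z)` vanishes. -/
structure KernHRegular (q c d e z : ℂ) : Prop where
  mul : QRegular q (c * z)
  div : QRegular q (c / z)
  mul_div_mul : QRegular q (c / (d * e) * z)
  div_mul_div : QRegular q (c / (d * e) / z)

lemma kernH_shift (hs0 : s ≠ 0) (hs1 : ‖s ^ 2‖ < 1) (c d e z : ℂ) :
    kernH (s ^ 2) (c * s ^ 3) (d * s ^ 2) (e * s ^ 2) z =
      qPochPair (s ^ 2) (c / d * s) z * qPochPair (s ^ 2) (c / e * s) z /
        (qPochPair (s ^ 2) (c * s ^ 3) z * ((1 - c / (d * e) / s * z) *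
          (1 - c / (d * e) / s / z) * qPochPair (s ^ 2) (c / (d * e) * s) z)) := by
  have hd : c * s ^ 3 / (d * s ^ 2) = c / d * s := by field_simp
  have he : c * s ^ 3 / (e * s ^ 2) = c / e * s := by field_simp
  have hde : c * s ^ 3 / (d * s ^ 2 * (e * s ^ 2)) = c / (d * e) / s := by field_simp
  have hmul : c / (d * e) / s * s ^ 2 = c / (d * e) * s := by field_simp
  rw [kernH_eq_qPochPair, hd, he, hde, qPochPair_eq_mul_mul_q hs1 (c / (d * e) / s), hmul]

lemma kernH_mul_left (hs0 : s ≠ 0) (hs1 : ‖s ^ 2‖ < 1) (h : 1 - c / (d * e) / s * z ≠ 0) :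
    kernH (s ^ 2) c d e (s * z) =
      (1 - c / d / s / z) * (1 - c / e / s / z) * (1 - c / (d * e) / s * z) /
          ((1 - c / s / z) * ((1 - c * s * z) * (1 - c * s / z))) *
        kernH (s ^ 2) (c * s ^ 3) (d * s ^ 2) (e * s ^ 2) z := by
  rw [kernH_shift hs0 hs1, kernH_eq_qPochPair]
  have hcs : c * s * s ^ 2 = c * s ^ 3 := by ring
  simp only [qPochPair_mul_left hs0 hs1]
  rw [qPochPair_eq_mul_mul_q hs1 (c * s), hcs, div_mul_div_comm, ← mul_div_mul_right _ _ h]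
  congr 1 <;> ring

lemma kernH_inv_mul_left (hs0 : s ≠ 0) (hs1 : ‖s ^ 2‖ < 1) (h : 1 - c / (d * e) / s / z ≠ 0) :
    kernH (s ^ 2) c d e (s⁻¹ * z) =
      (1 - c / d / s * z) * (1 - c / e / s * z) * (1 - c / (d * e) / s / z) /
          ((1 - c / s * z) * ((1 - c * s * z) * (1 - c * s / z))) *
        kernH (s ^ 2) (c * s ^ 3) (d * s ^ 2) (e * s ^ 2) z := by
  rw [kernH_shift hs0 hs1, kernH_eq_qPochPair]
  have hcs : c * s * s ^ 2 = c * s ^ 3 := by ring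
  simp only [qPochPair_inv_mul_left hs0 hs1]
  rw [qPochPair_eq_mul_mul_q hs1 (c * s), hcs, div_mul_div_comm, ← mul_div_mul_right _ _ h]
  congr 1 <;> ring

lemma well_poised_antisymm {p r t w : ℂ} (hz : z ≠ 0) (h : p * r = t * w) :
    (1 - p / z) * (1 - r / z) * ((1 - t * z) * (1 - w * z)) -
      (1 - p * z) * (1 - r * z) * ((1 - t / z) * (1 - w / z)) =
    (p + r - t - w) * (1 - t * w) * (z - z⁻¹) := by
  field_simp
  linear_combination (1 - z ^ 4 + (z ^ 3 - z) * (t + w)) * h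

/-- The factor by which `D_{c,q}` multiplies the kernel `H` when it shifts its parameters. -/
noncomputable def kernFactor (q c d e : ℂ) : ℂ :=
  2 * c / (d * e * (1 - q)) * ((1 - d) * (1 - e) * (1 - c ^ 2 / (d * e * q)))

lemma kernFactor_mul (hs0 : s ≠ 0) (hs1 : 1 - s ^ 2 ≠ 0) (hd : d ≠ 0) (he : e ≠ 0) :
    kernFactor (s ^ 2) c d e * ((s - s⁻¹) / 2) =
      (c / d / s + c / e / s - c / s - c / (d * e) / s) * (1 - c / s * (c / (d * e) / s)) := by
  rw [kernFactor]
  field_simp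
  ring

lemma wpD_kernH (hs0 : s ≠ 0) (hs1 : ‖s ^ 2‖ < 1) (hd : d ≠ 0) (he : e ≠ 0) (hz : z ≠ 0)
    (hz2 : z - z⁻¹ ≠ 0) (h : KernHRegular (s ^ 2) c d e (s * z))
    (h' : KernHRegular (s ^ 2) c d e (s⁻¹ * z)) :
    wpD s c (kernH (s ^ 2) c d e) z =
      kernFactor (s ^ 2) c d e * kernH (s ^ 2) (c * s ^ 3) (d * s ^ 2) (e * s ^ 2) z := by
  have hsq : 1 - s ^ 2 ≠ 0 := (qRegular_self hs1).one_sub_ne_zero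
  have hss : s - s⁻¹ ≠ 0 := by
    rw [← neg_sub, neg_ne_zero]
    convert mul_ne_zero (inv_ne_zero hs0) hsq using 1
    field_simp
  have hcs : 1 - c * s * z ≠ 0 := by
    convert h.mul.one_sub_ne_zero using 2; ring
  have hcs' : 1 - c * s / z ≠ 0 := by
    convert h'.div.one_sub_ne_zero using 2; field_simp
  have ht : 1 - c / s / z ≠ 0 := by
    convert h.div.one_sub_ne_zero using 2; field_simp
  have ht' : 1 - c / s * z ≠ 0 := by
    convert h'.mul.one_sub_ne_zero using 2; field_simp
  have hw : 1 - c / (d * e) / s / z ≠ 0 := by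
    convert h.div_mul_div.one_sub_ne_zero using 2; field_simp
  have hw' : 1 - c / (d * e) / s * z ≠ 0 := by
    convert h'.mul_div_mul.one_sub_ne_zero using 2; field_simp
  have key := well_poised_antisymm (p := c / d / s) (r := c / e / s) (t := c / s)
    (w := c / (d * e) / s) hz (by field_simp)
  rw [← kernFactor_mul hs0 hsq hd he] at key
  rw [wpD, askeyWilsonD, kernH_mul_left hs0 hs1 hw', kernH_inv_mul_left hs0 hs1 hw,
    mul_right_comm c z, mul_right_comm c z, ← div_eq_mul_inv c s, mul_div_assoc',
    div_eq_iff (div_ne_zero (mul_ne_zero hss hz2) two_ne_zero)]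
  have hclear : ∀ {D D' E E' : ℂ}, D ≠ 0 → D' ≠ 0 → E ≠ 0 → E' ≠ 0 → ∀ N N' H' : ℂ,
      D' * E * D * E' * (N / (D * (E * E')) * H' - N' / (D' * (E * E')) * H') =
        (N * D' - N' * D) * H' := by
    intros
    field_simp
  rw [hclear ht ht' hcs hcs']
  linear_combination kernH (s ^ 2) (c * s ^ 3) (d * s ^ 2) (e * s ^ 2) z * key

lemma wpD_eq_mul (h : F (s * z) = κ * G (s * z)) (h' : F (s⁻¹ * z) = κ * G (s⁻¹ * z)) :
    wpD s c F z = κ * wpD s c G z := by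
  rw [wpD, wpD, askeyWilsonD, askeyWilsonD, h, h']
  ring

lemma QRegular.div_pow (hq0 : q ≠ 0) (hx : QRegular q x) (hx' : QRegular q x⁻¹) (n : ℕ) :
    QRegular q (x / q ^ n) := by
  intro m hm
  have hqm := pow_ne_zero m hq0
  have hqn := pow_ne_zero n hq0
  have hxm : x * q ^ m = q ^ n := by
    rwa [div_mul_eq_mul_div, div_eq_one_iff_eq hqn] at hm
  rcases le_total n m with hnm | hmn
  · refine hx (m - n) ?_
    rw [pow_sub₀ q hq0 hnm, ← mul_assoc, hxm, mul_inv_cancel₀ hqn]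
  · refine hx' (n - m) ?_
    have hx0 : x ≠ 0 := left_ne_zero_of_mul (hxm ▸ hqn)
    rw [pow_sub₀ q hq0 hmn, ← hxm, mul_inv_cancel_right₀ hqm, inv_mul_cancel₀ hx0]

lemma QRegular.div_q (hq0 : q ≠ 0) (hx : QRegular q x) (hne : x ≠ q) : QRegular q (x / q) := by
  rintro (_ | m) hm
  · exact hne (by rwa [pow_zero, mul_one, div_eq_one_iff_eq hq0] at hm)
  · exact hx m (by rwa [pow_succ', ← mul_assoc, div_mul_cancel₀ _ hq0] at hm)

lemma Generic.kernHRegular_grid (hs0 : s ≠ 0) (h : Generic (s ^ 2) b c d e) (k m : ℕ) :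
    KernHRegular (s ^ 2) (c * s ^ (3 * k)) (d * (s ^ 2) ^ k) (e * (s ^ 2) ^ k)
      (b * s ^ k * (s ^ 2) ^ m) := by
  have hb := h.b_ne
  have hc := h.c_ne
  have hd := h.d_ne
  have he := h.e_ne
  have hq0 : s ^ 2 ≠ 0 := pow_ne_zero 2 hs0
  constructor
  · convert h.reg_bc.mul_pow (2 * k + m) using 1
    ring
  · have hinv : QRegular (s ^ 2) (c / b * (s ^ 2) ^ k)⁻¹ := by
      convert h.reg_b_div_c.div_pow hq0 (inv_div b c ▸ h.reg_c_div_b) k using 1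
      field_simp
    convert (h.reg_c_div_b.mul_pow k).div_pow hq0 hinv m using 1
    field_simp
    ring
  · convert h.reg_bc_div_de.mul_pow m using 1
    field_simp
    ring
  · convert h.reg_c_div_bde.div_pow hq0 (inv_div c _ ▸ h.reg_bde_div_c) (k + m) using 1
    field_simp
    ring

lemma Generic.grid_sub_inv_ne_zero (hs0 : s ≠ 0) (h : Generic (s ^ 2) b c d e) (k m : ℕ) :
    b * s ^ (k + 1) * (s ^ 2) ^ m - (b * s ^ (k + 1) * (s ^ 2) ^ m)⁻¹ ≠ 0 := by
  intro h0
  refine h.grid_b (k + 1 + 2 * m) (Nat.le_add_right_of_le (Nat.le_add_left 1 k)) ?_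
  have hb := h.b_ne
  rw [sub_eq_zero, ← mul_eq_one_iff_eq_inv₀ (by positivity)] at h0
  linear_combination h0

lemma kernFactor_mul_pow (hs0 : s ≠ 0) (hd : d ≠ 0) (he : e ≠ 0) (k : ℕ) :
    kernFactor (s ^ 2) (c * s ^ (3 * k)) (d * (s ^ 2) ^ k) (e * (s ^ 2) ^ k) =
      2 * c / (d * e * (1 - s ^ 2)) * (s ^ k)⁻¹ * ((1 - d * (s ^ 2) ^ k) * (1 - e * (s ^ 2) ^ k) *
        (1 - c ^ 2 / (d * e * s ^ 2) * (s ^ 2) ^ k)) := by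
  have hsum : (c * s ^ (3 * k)) ^ 2 / (d * (s ^ 2) ^ k * (e * (s ^ 2) ^ k) * s ^ 2) =
      c ^ 2 / (d * e * s ^ 2) * (s ^ 2) ^ k := by
    field_simp
    ring
  have hpref : 2 * (c * s ^ (3 * k)) / (d * (s ^ 2) ^ k * (e * (s ^ 2) ^ k) * (1 - s ^ 2)) =
      2 * c / (d * e * (1 - s ^ 2)) * (s ^ k)⁻¹ := by
    generalize 1 - s ^ 2 = S
    field_simp
    ring
  rw [kernFactor, hsum, hpref]

lemma wpDIter_kernH (hs0 : s ≠ 0) (hs1 : ‖s ^ 2‖ < 1) (h : Generic (s ^ 2) b c d e) (k m : ℕ) :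
    wpDIter s c k (kernH (s ^ 2) c d e) (b * s ^ k * (s ^ 2) ^ m) =
      (2 * c / (d * e * (1 - s ^ 2))) ^ k * (s ^ k.choose 2)⁻¹ *
        (qPoch (s ^ 2) d k * qPoch (s ^ 2) e k * qPoch (s ^ 2) (c ^ 2 / (d * e * s ^ 2)) k) *
        kernH (s ^ 2) (c * s ^ (3 * k)) (d * (s ^ 2) ^ k) (e * (s ^ 2) ^ k)
          (b * s ^ k * (s ^ 2) ^ m) := by
  have hb := h.b_ne
  have hd := h.d_ne
  have he := h.e_ne
  induction k generalizing m with
  | zero => simp only [wpDIter, qPoch_zero, pow_zero, mul_zero, mul_one, one_mul,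
      Nat.choose_zero_succ, inv_one]
  | succ k ih =>
    set z := b * s ^ (k + 1) * (s ^ 2) ^ m with hz
    have hz0 : z ≠ 0 := by positivity
    have hup : b * s ^ k * (s ^ 2) ^ (m + 1) = s * z := by
      rw [hz]
      ring
    have hdown : b * s ^ k * (s ^ 2) ^ m = s⁻¹ * z := by
      rw [hz]
      field_simp
      ring
    have hchoose : (k + 1).choose 2 = k + k.choose 2 := by
      rw [Nat.choose_succ_succ', Nat.choose_one_right]
    have hcs : c * s ^ (3 * k) * s ^ 3 = c * s ^ (3 * (k + 1)) := by ring
    have hpow : ∀ x : ℂ, x * (s ^ 2) ^ k * s ^ 2 = x * (s ^ 2) ^ (k + 1) := fun x => by ring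
    rw [wpDIter, wpD_eq_mul (hup ▸ ih (m + 1)) (hdown ▸ ih m),
      wpD_kernH hs0 hs1 (by positivity) (by positivity) hz0 (h.grid_sub_inv_ne_zero hs0 k m)
        (hup ▸ h.kernHRegular_grid hs0 k (m + 1)) (hdown ▸ h.kernHRegular_grid hs0 k m),
      kernFactor_mul_pow hs0 hd he, hchoose, hcs, hpow d, hpow e, pow_add s k (k.choose 2), mul_inv,
      pow_succ (2 * c / (d * e * (1 - s ^ 2)))]
    simp only [qPoch_succ]
    ring

lemma qPoch_reflect (hq0 : q ≠ 0) (hx : x ≠ 0) (k : ℕ) :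
    qPoch q (x * q) k = (-x) ^ k * q ^ (k + k.choose 2) * qPoch q (x⁻¹ * (q ^ k)⁻¹) k := by
  induction k with
  | zero => simp only [qPoch_zero, pow_zero, Nat.choose_zero_succ, add_zero, mul_one]
  | succ k ih =>
    have hshift : x⁻¹ * (q ^ (k + 1))⁻¹ * q = x⁻¹ * (q ^ k)⁻¹ := by
      field_simp
      ring
    have hchoose : (k + 1) + (k + 1).choose 2 = (k + k.choose 2) + (k + 1) := by
      rw [Nat.choose_succ_succ', Nat.choose_one_right]
      ring
    have hfactor : 1 - x * q * q ^ k = -x * q ^ (k + 1) * (1 - x⁻¹ * (q ^ (k + 1))⁻¹) := by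
      field_simp
      ring
    rw [qPoch_succ, ih, qPoch_succ', hshift, hchoose, hfactor]
    ring

lemma qPoch_two_mul (hq0 : q ≠ 0) (x : ℂ) (k : ℕ) :
    qPoch q x (2 * k) * (1 - x / q) =
      qPoch q (x / q) k * (1 - x * q ^ (2 * k) / q) * qPoch q (x * q ^ k / q) k := by
  have hsplit := qPoch_succ' q (x / q) (2 * k)
  rw [div_mul_cancel₀ x hq0, qPoch_succ, two_mul, qPoch_add, ← two_mul, div_mul_eq_mul_div,
    div_mul_eq_mul_div] at hsplit
  rw [mul_comm, ← hsplit, mul_right_comm]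

lemma qPochPair_eq_qPoch_mul_grid (hs0 : s ≠ 0) (hs1 : ‖s ^ 2‖ < 1) (x z : ℂ) (k : ℕ) :
    qPochPair (s ^ 2) x z =
      qPoch (s ^ 2) (x * z) k * qPochPair (s ^ 2) (x * s ^ k) (z * s ^ k) := by
  have hmul : x * s ^ k * (z * s ^ k) = x * z * (s ^ 2) ^ k := by ring
  rw [qPochPair, qPochPair, qPochInf_eq_qPoch_mul hs1 (x * z) k, hmul,
    mul_div_mul_right _ _ (pow_ne_zero k hs0), mul_assoc]

lemma qPochPair_grid_eq_qPoch_mul (hs0 : s ≠ 0) (hs1 : ‖s ^ 2‖ < 1) (x z : ℂ) (k : ℕ) :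
    qPochPair (s ^ 2) (x * (s ^ k)⁻¹) (z * s ^ k) =
      qPoch (s ^ 2) (x / z * ((s ^ 2) ^ k)⁻¹) k * qPochPair (s ^ 2) x z := by
  have hmul : x * (s ^ k)⁻¹ * (z * s ^ k) = x * z := by field_simp
  have hdiv : x * (s ^ k)⁻¹ / (z * s ^ k) = x / z * ((s ^ 2) ^ k)⁻¹ := by
    field_simp
    ring
  rw [qPochPair, qPochPair, hmul, hdiv, qPochInf_eq_qPoch_mul hs1 (x / z * _) k,
    inv_mul_cancel_right₀ (pow_ne_zero k (pow_ne_zero 2 hs0))]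
  ring

lemma Generic.kernH_grid (hs0 : s ≠ 0) (hs1 : ‖s ^ 2‖ < 1) (h : Generic (s ^ 2) b c d e) (k : ℕ) :
    kernH (s ^ 2) (c * s ^ (3 * k)) (d * (s ^ 2) ^ k) (e * (s ^ 2) ^ k) (b * s ^ k) =
      kernH (s ^ 2) c d e b * (qPoch (s ^ 2) (b * c) (2 * k) * qPoch (s ^ 2) (c / b) k /
        (qPoch (s ^ 2) (b * c / d) k * qPoch (s ^ 2) (b * c / e) k *
          qPoch (s ^ 2) (c / (b * d * e) * ((s ^ 2) ^ k)⁻¹) k)) := by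
  have hgrid := qPochPair_eq_qPoch_mul_grid hs0 hs1
  have hsk := pow_ne_zero k hs0
  have hnum (x : ℂ) : c * s ^ (3 * k) / (x * (s ^ 2) ^ k) = c / x * s ^ k := by
    field_simp
    ring
  have hden : c * s ^ (3 * k) / (d * (s ^ 2) ^ k * (e * (s ^ 2) ^ k)) =
      c / (d * e) * (s ^ k)⁻¹ := by
    field_simp
    ring
  have hc : qPochPair (s ^ 2) c b = qPoch (s ^ 2) (b * c) (2 * k) * qPoch (s ^ 2) (c / b) k *
      qPochPair (s ^ 2) (c * s ^ (3 * k)) (b * s ^ k) := by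
    have hmul : c * s ^ k * (b * s ^ k) = b * c * (s ^ 2) ^ k := by ring
    have hpow : c * s ^ k * (s ^ 2) ^ k = c * s ^ (3 * k) := by ring
    rw [hgrid c b k, qPochPair_eq_qPoch_mul hs1 (c * s ^ k) _ k, hmul,
      mul_div_mul_right _ _ hsk, hpow, mul_comm c b, two_mul, qPoch_add]
    ring
  rw [kernH_eq_qPochPair, kernH_eq_qPochPair, hnum, hnum, hden,
    qPochPair_grid_eq_qPoch_mul hs0 hs1, hgrid (c / d) b k, hgrid (c / e) b k, hc,
    div_mul_eq_mul_div c d b, div_mul_eq_mul_div c e b, mul_comm c b, div_div, mul_comm (d * e) b,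
    ← mul_assoc b d e]
  have hclear : ∀ {M M' N N' : ℂ}, M ≠ 0 → M' ≠ 0 → N ≠ 0 → N' ≠ 0 → ∀ U U' V V' Y : ℂ,
      U * U' / (V * (Y * V')) = N * U * (N' * U') / (M * M' * V * V') *
        (M * M' / (N * N' * Y)) := by
    intros
    field_simp
  exact hclear (h.reg_bc.qPoch_ne_zero _) (h.reg_c_div_b.qPoch_ne_zero k)
    (h.reg_bc_div_d.qPoch_ne_zero k) (h.reg_bc_div_e.qPoch_ne_zero k) _ _ _ _ _

lemma taylor_prefactor (hs0 : s ≠ 0) (hs1 : ‖s ^ 2‖ < 1) (hb : b ≠ 0) (hc : c ≠ 0) (hd : d ≠ 0)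
    (he : e ≠ 0) (k : ℕ) :
    (-1) ^ k * (s ^ k.choose 2)⁻¹ * (1 - s ^ 2) ^ k / (2 * b) ^ k *
        ((2 * c / (d * e * (1 - s ^ 2))) ^ k * (s ^ k.choose 2)⁻¹) /
          qPoch (s ^ 2) (c / (b * d * e) * ((s ^ 2) ^ k)⁻¹) k =
      (s ^ 2) ^ k / qPoch (s ^ 2) (b * d * e * s ^ 2 / c) k := by
  have hx : b * d * e / c ≠ 0 := by positivity
  have hsq : 1 - s ^ 2 ≠ 0 := (qRegular_self hs1).one_sub_ne_zero
  have hpow : (-1) ^ k * (1 - s ^ 2) ^ k / (2 * b) ^ k * (2 * c / (d * e * (1 - s ^ 2))) ^ k =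
      ((-(b * d * e / c)) ^ k)⁻¹ := by
    simp only [← mul_pow, ← div_pow, ← inv_pow]
    congr 1
    generalize 1 - s ^ 2 = S at *
    field_simp
  have hS : s ^ k.choose 2 ≠ 0 := pow_ne_zero _ hs0
  have hsk : (s ^ 2) ^ k ≠ 0 := pow_ne_zero _ (pow_ne_zero 2 hs0)
  have hchoose : (s ^ 2) ^ k.choose 2 = s ^ k.choose 2 * s ^ k.choose 2 := by ring
  rw [mul_div_right_comm _ (s ^ 2) c, qPoch_reflect (pow_ne_zero 2 hs0) hx, inv_div, pow_add,
    hchoose]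
  calc _ = (-1) ^ k * (1 - s ^ 2) ^ k / (2 * b) ^ k * (2 * c / (d * e * (1 - s ^ 2))) ^ k *
        (s ^ k.choose 2 * s ^ k.choose 2)⁻¹ /
          qPoch (s ^ 2) (c / (b * d * e) * ((s ^ 2) ^ k)⁻¹) k := by
        rw [mul_inv]
        ring
    _ = _ := by
      rw [hpow]
      field_simp

theorem Generic.taylorCoeff_kernH (hs0 : s ≠ 0) (hs1 : ‖s ^ 2‖ < 1)
    (h : Generic (s ^ 2) b c d e) (k : ℕ) :
    taylorCoeff (s ^ 2) s b c (kernH (s ^ 2) c d e) k =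
      kernH (s ^ 2) c d e b * coeffF (s ^ 2) b c d e k := by
  have hq0 : s ^ 2 ≠ 0 := pow_ne_zero 2 hs0
  have hbc : QRegular (s ^ 2) (b * c / s ^ 2) := h.reg_bc.div_q hq0 h.bc_ne_q
  have hbck : qPoch (s ^ 2) (b * c * (s ^ 2) ^ k / s ^ 2) k ≠ 0 :=
    mul_div_right_comm (b * c) ((s ^ 2) ^ k) _ ▸ (hbc.mul_pow k).qPoch_ne_zero k
  have htwo := qPoch_two_mul hq0 (b * c) k
  rw [← eq_div_iff hbc.one_sub_ne_zero] at htwo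
  have hiter := wpDIter_kernH hs0 hs1 h k 0
  rw [pow_zero, mul_one, h.kernH_grid hs0 hs1, htwo] at hiter
  have hclear : ∀ {M N : ℂ}, M ≠ 0 → N ≠ 0 → ∀ t t' Q T P K R D U Y : ℂ,
      t / (t' * (Q * M * N)) * (T * P * (K * (R * N / D * M / (U * Y)))) =
        K * (t / t' * T / Y) * (P * R / D / (Q * U)) := by
    intros
    field_simp
  rw [taylorCoeff, hiter, hclear (h.reg_c_div_b.qPoch_ne_zero k) hbck,
    taylor_prefactor hs0 hs1 h.b_ne h.c_ne h.d_ne h.e_ne, coeffF]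
  simp only [div_eq_mul_inv, mul_inv]
  ring

end Taylor

section Involution

variable {q b c d e : ℂ}

lemma Generic.involution (h : Generic q b c d e) :
    Generic q (c / (d * e)) (c ^ 2 / (b * d * e)) (c / (b * e)) (c / (b * d)) := by
  have hb := h.b_ne
  have hc := h.c_ne
  have hd := h.d_ne
  have he := h.e_ne
  exact {
    b_ne := by positivity
    c_ne := by positivity
    d_ne := by positivity
    e_ne := by positivity
    reg_bc := by convert h.reg_c3 using 1; field_simp
    reg_c_div_b := by convert h.reg_c_div_b using 1; field_simp
    reg_bc_div_de := by convert h.reg_bc_div_de using 1; field_simp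
    reg_c_div_bde := by convert h.reg_bde_div_c using 1; field_simp
    reg_bde_div_c := by convert h.reg_c_div_bde using 1; field_simp
    reg_c3 := by convert h.reg_bc using 1; field_simp
    bc_ne_q := by convert h.c3_ne_q using 1; field_simp
    reg_bc_div_d := by convert h.reg_c2_div_d2e using 1; field_simp
    reg_bc_div_e := by convert h.reg_c2_div_de2 using 1; field_simp
    c3_ne_q := by convert h.bc_ne_q using 1; field_simp
    reg_c2_div_de2 := by convert h.reg_bc_div_e using 1; field_simp
    reg_c2_div_d2e := by convert h.reg_bc_div_d using 1; field_simp
    reg_b_div_c := by convert h.reg_b_div_c using 1; field_simp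
    grid_b := h.grid_c_div_de
    grid_c_div_de := fun i hi => by convert h.grid_b i hi using 2; field_simp }

lemma Generic.involution_involution (h : Generic q b c d e) :
    c ^ 2 / (b * d * e) / (c / (b * e) * (c / (b * d))) = b ∧
      (c ^ 2 / (b * d * e)) ^ 2 / (c / (d * e) * (c / (b * e)) * (c / (b * d))) = c ∧
      c ^ 2 / (b * d * e) / (c / (d * e) * (c / (b * d))) = d ∧
      c ^ 2 / (b * d * e) / (c / (d * e) * (c / (b * e))) = e := by
  have hb := h.b_ne
  have hc := h.c_ne
  have hd := h.d_ne
  have he := h.e_ne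
  refine ⟨?_, ?_, ?_, ?_⟩ <;> field_simp

lemma Generic.kernK_eq_kernH (h : Generic q b c d e) :
    kernK q b c d e = kernH q (c ^ 2 / (b * d * e)) (c / (b * e)) (c / (b * d)) := by
  have hb := h.b_ne
  have hc := h.c_ne
  have hcd : c ^ 2 / (b * d * e) / (c / (b * e)) = c / d := by have := h.e_ne; field_simp
  have hce : c ^ 2 / (b * d * e) / (c / (b * d)) = c / e := by have := h.d_ne; field_simp
  funext z
  simp only [kernH_eq_qPochPair, hcd, hce, h.involution_involution.1]
  simp only [kernK, qPochPair, ← div_div _ _ z, mul_div_right_comm _ z]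
  ring

lemma Generic.coeffG_eq_coeffF (h : Generic q b c d e) :
    coeffG q b c d e =
      coeffF q (c / (d * e)) (c ^ 2 / (b * d * e)) (c / (b * e)) (c / (b * d)) := by
  have hb := h.b_ne
  have hc := h.c_ne
  have hd := h.d_ne
  have he := h.e_ne
  have hbc : c / (d * e) * (c ^ 2 / (b * d * e)) = c ^ 3 / (b * d ^ 2 * e ^ 2) := by field_simp
  have hc2 : (c ^ 2 / (b * d * e)) ^ 2 / (c / (b * e) * (c / (b * d))) = c ^ 2 / (d * e) := by
    field_simp
  have hbde : c / (d * e) * (c / (b * e)) * (c / (b * d)) * q / (c ^ 2 / (b * d * e)) =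
      c * q / (b * d * e) := by field_simp
  have hbcd : c ^ 3 / (b * d ^ 2 * e ^ 2) / (c / (b * e)) = c ^ 2 / (d ^ 2 * e) := by field_simp
  have hbce : c ^ 3 / (b * d ^ 2 * e ^ 2) / (c / (b * d)) = c ^ 2 / (d * e ^ 2) := by field_simp
  funext k
  simp only [coeffG, coeffF, ← div_div _ _ q, mul_div_right_comm _ (q ^ (2 * k)), hbc, hc2, hbde,
    hbcd, hbce]
  ring

lemma Psi_eq_Phi (q b c d e : ℂ) :
    Psi q b c d e = Phi q (c / (d * e)) (c ^ 2 / (b * d * e)) := by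
  funext k z
  simp only [Psi, Phi, ← div_div _ _ z, mul_div_right_comm _ z]

lemma Generic.prefB_eq_prefA (h : Generic q b c d e) :
    prefB q b c =
      prefA q (c / (d * e)) (c ^ 2 / (b * d * e)) (c / (b * e)) (c / (b * d)) := by
  obtain ⟨hb, hc, -, -⟩ := h.involution_involution
  funext z
  simp only [prefB, prefA, ← div_div _ _ z, mul_div_right_comm _ z, hb, hc]

lemma Generic.contribPsi_eq_contribPhi (h : Generic q b c d e) :
    contribPsi q b c d e =
      contribPhi q (c / (d * e)) (c ^ 2 / (b * d * e)) (c / (b * e)) (c / (b * d)) := by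
  funext z
  simp only [contribPsi, contribPhi, h.kernK_eq_kernH, h.coeffG_eq_coeffF, Psi_eq_Phi,
    h.prefB_eq_prefA]

lemma Generic.contribPhi_eq_contribPsi (h : Generic q b c d e) :
    contribPhi q b c d e =
      contribPsi q (c / (d * e)) (c ^ 2 / (b * d * e)) (c / (b * e)) (c / (b * d)) := by
  obtain ⟨hb, hc, hd, he⟩ := h.involution_involution
  rw [h.involution.contribPsi_eq_contribPhi, hb, hc, hd, he]

lemma Generic.admissibleK_eq_admissibleH (h : Generic q b c d e) :
    admissibleK q b c d e =
      admissibleH q (c / (d * e)) (c ^ 2 / (b * d * e)) (c / (b * e)) (c / (b * d)) := by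
  obtain ⟨hb, hc, -, -⟩ := h.involution_involution
  ext z
  simp only [admissibleK, admissibleH, poleFree, Set.mem_ofPred_eq, ← div_div _ _ z,
    mul_div_right_comm _ z, hb, hc]
  tauto

lemma Generic.admissibleH_eq_admissibleK (h : Generic q b c d e) :
    admissibleH q b c d e =
      admissibleK q (c / (d * e)) (c ^ 2 / (b * d * e)) (c / (b * e)) (c / (b * d)) := by
  obtain ⟨hb, hc, hd, he⟩ := h.involution_involution
  rw [h.involution.admissibleK_eq_admissibleH, hb, hc, hd, he]

lemma Generic.poleFree_involution (h : Generic q b c d e) :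
    poleFree q (c / (d * e)) (c ^ 2 / (b * d * e)) (c / (b * e)) (c / (b * d)) =
      poleFree q b c d e := by
  have hc := h.involution_involution.2.1
  ext z
  simp only [poleFree, Set.mem_ofPred_eq, ← div_div _ _ z, mul_div_right_comm _ z, hc]
  tauto

end Involution

section Expansion

variable {q b c d e z : ℂ}

lemma Generic.wpRegular (hq0 : q ≠ 0) (h : Generic q b c d e) :
    WPRegular q b (c / (d * e)) (c / d * (c / e)) := by
  have hb := h.b_ne
  have hc := h.c_ne
  have hd := h.d_ne
  have he := h.e_ne
  exact {
    b_ne := hb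
    β_ne := by positivity
    div_right := by convert h.reg_bde_div_c using 1; field_simp
    div_left := by convert h.reg_c_div_bde using 1; field_simp
    mul_div_right := by convert h.reg_bc.div_q hq0 h.bc_ne_q using 1; field_simp
    mul_div_left := by convert h.reg_c3.div_q hq0 h.c3_ne_q using 1; field_simp }

lemma Generic.kernH_eq_mul_div (hq0 : q ≠ 0) (hq1 : ‖q‖ < 1) (h : Generic q b c d e) (k : ℕ) :
    kernH q c d e b =
      qPoch q (b * c / d) k * qPoch q (b * c / e) k * (1 - b * c / q) / qPoch q (b * c / q) k *
        (qPochInf q (c / d * b * q ^ k) * qPochInf q (c / e * b * q ^ k) * qPochInf q (c / d / b) *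
            qPochInf q (c / e / b) /
          (qPochInf q (b * c / q * q ^ k) * qPochInf q (c / (d * e) / b) *
            (qPochInf q (c / b) * qPochInf q (b * c / (d * e))))) := by
  have hbcq : 1 - b * c / q ≠ 0 := (h.reg_bc.div_q hq0 h.bc_ne_q).one_sub_ne_zero
  have hbc : qPochInf q (c * b) =
      qPoch q (b * c / q) k * qPochInf q (b * c / q * q ^ k) / (1 - b * c / q) := by
    rw [eq_div_iff hbcq, ← qPochInf_eq_qPoch_mul hq1, qPochInf_eq_one_sub_mul hq1 (b * c / q),
      div_mul_cancel₀ _ hq0, mul_comm c b, mul_comm]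
  have hnum (x : ℂ) : qPochInf q (c / x * b) =
      qPoch q (b * c / x) k * qPochInf q (c / x * b * q ^ k) := by
    rw [qPochInf_eq_qPoch_mul hq1 _ k, div_mul_eq_mul_div, mul_comm c b]
  rw [kernH_eq_qPochPair]
  simp only [qPochPair]
  rw [hnum, hnum, hbc, div_mul_eq_mul_div c (d * e), mul_comm c b]
  simp only [div_eq_mul_inv, mul_inv, inv_inv]
  ring

lemma Generic.kernH_mul_coeffF (hq0 : q ≠ 0) (hq1 : ‖q‖ < 1) (h : Generic q b c d e) (k : ℕ) :
    kernH q c d e b * coeffF q b c d e k =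
      wpCoeff q b (c / (d * e)) (c / d) (c / e) k * q ^ k /
        (qPochInf q (c / b) * qPochInf q (b * c / (d * e))) := by
  have hbcq := h.reg_bc.div_q hq0 h.bc_ne_q
  have hc := h.c_ne
  have hd := h.d_ne
  have he := h.e_ne
  have hM : c / d * (c / e) * (b / (c / (d * e))) / q = b * c / q := by field_simp
  have hu : c / d / (c / (d * e)) = e := by field_simp
  have hv : c / e / (c / (d * e)) = d := by field_simp
  have huv : c / d * (c / e) / q = c ^ 2 / (d * e * q) := by field_simp
  have hbβ : b / (c / (d * e)) * q = b * d * e * q / c := by field_simp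
  have hclear : ∀ {P P' W R : ℂ}, P ≠ 0 → P' ≠ 0 → W ≠ 0 → R ≠ 0 → ∀ N T Q Q' S x : ℂ,
      P * P' * W / R * N * (T / W * (R * S / (Q * P * P' * Q')) * x) =
        N * (T * S / (Q * Q')) * x := by
    intros
    field_simp
  have hterm : coeffF q b c d e k = (1 - b * c / q * q ^ (2 * k)) / (1 - b * c / q) *
      (qPoch q (b * c / q) k * (qPoch q e k * qPoch q d k * qPoch q (c ^ 2 / (d * e * q)) k) /
        (qPoch q q k * qPoch q (b * c / d) k * qPoch q (b * c / e) k *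
          qPoch q (b * d * e * q / c) k)) * q ^ k := by
    rw [coeffF, mul_div_right_comm]
    ring
  rw [h.kernH_eq_mul_div hq0 hq1 k, hterm, hclear (h.reg_bc_div_d.qPoch_ne_zero k)
    (h.reg_bc_div_e.qPoch_ne_zero k) hbcq.one_sub_ne_zero (hbcq.qPoch_ne_zero k), wpCoeff, hM, hu,
    hv, huv, hbβ]
  simp only [div_eq_mul_inv, mul_inv]
  ring

lemma Phi_eq_wpMonomial_div (hq1 : ‖q‖ < 1) (hmul : QRegular q (c * z)) (hdiv : QRegular q (c / z))
    (b : ℂ) (k : ℕ) :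
    Phi q b c k z = wpMonomial q b c z k / qPochPair q c z := by
  have hne := mul_ne_zero ((hmul.mul_pow k).qPochInf_ne_zero hq1)
    ((hdiv.mul_pow k).qPochInf_ne_zero hq1)
  rw [Phi, wpMonomial, qPochPair, qPochInf_eq_qPoch_mul hq1 (c * z) k,
    qPochInf_eq_qPoch_mul hq1 (c / z) k, mul_mul_mul_comm (qPoch q (c * z) k),
    mul_div_mul_right _ _ hne]

lemma prefA_eq_qPochPair (q b c d e z : ℂ) :
    prefA q b c d e z = qPochPair q (c / (d * e)) z / qPochPair q (c ^ 2 / (b * d * e)) z := by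
  simp only [prefA, qPochPair, ← div_div _ _ z, mul_div_right_comm _ z]

lemma Generic.contribPhi_eq_wpSeries_div (hq0 : q ≠ 0) (hq1 : ‖q‖ < 1) (h : Generic q b c d e)
    (hmul : QRegular q (c * z)) (hdiv : QRegular q (c / z)) :
    contribPhi q b c d e z = wpSeries q b (c / (d * e)) (c / d) (c / e) z /
      (qPochInf q (c / b) * qPochInf q (b * c / (d * e)) *
        (qPochPair q c z * qPochPair q (c ^ 2 / (b * d * e)) z)) := by
  have huv : c / d * (c / e) / (c / (d * e)) = c := by
    have := h.c_ne
    have := h.d_ne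
    have := h.e_ne
    field_simp
  have hterm : ∀ k, kernH q c d e b * (coeffF q b c d e k * Phi q b c k z) =
      wpCoeff q b (c / (d * e)) (c / d) (c / e) k * wpMonomial q b c z k * q ^ k /
        (qPochInf q (c / b) * qPochInf q (b * c / (d * e)) * qPochPair q c z) := fun k => by
    rw [← mul_assoc, h.kernH_mul_coeffF hq0 hq1, Phi_eq_wpMonomial_div hq1 hmul hdiv,
      div_mul_div_comm, mul_right_comm]
  rw [contribPhi, mul_assoc, ← tsum_mul_left, funext hterm, tsum_div_const, wpSeries, huv,
    prefA_eq_qPochPair, div_mul_div_comm]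
  congr 1
  ring

lemma Generic.contribPsi_eq_wpSeries_div (hq0 : q ≠ 0) (hq1 : ‖q‖ < 1) (h : Generic q b c d e)
    (hmul : QRegular q (c ^ 2 / (b * d * e) * z)) (hdiv : QRegular q (c ^ 2 / (b * d * e) / z)) :
    contribPsi q b c d e z = wpSeries q (c / (d * e)) b (c / d) (c / e) z /
      (qPochInf q (c / b) * qPochInf q (b * c / (d * e)) *
        (qPochPair q c z * qPochPair q (c ^ 2 / (b * d * e)) z)) := by
  have hb := h.b_ne
  have hc := h.c_ne
  have hd := h.d_ne
  have he := h.e_ne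
  have hcd : c ^ 2 / (b * d * e) / (c / (b * e)) = c / d := by field_simp
  have hce : c ^ 2 / (b * d * e) / (c / (b * d)) = c / e := by field_simp
  have hcb : c ^ 2 / (b * d * e) / (c / (d * e)) = c / b := by field_simp
  have hbcde : c / (d * e) * b = b * c / (d * e) := by ring
  obtain ⟨hb', hc', -, -⟩ := h.involution_involution
  rw [h.contribPsi_eq_contribPhi, h.involution.contribPhi_eq_wpSeries_div hq0 hq1 hmul hdiv, hc',
    mul_div_assoc (c / (d * e)), hb', hcd, hce, hcb, hbcde, mul_comm (qPochPair q c z)]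

theorem Generic.prefA_mul_kernH (hq0 : q ≠ 0) (hq1 : ‖q‖ < 1) (h : Generic q b c d e)
    (hz : z ∈ admissibleH q b c d e) :
    prefA q b c d e z * kernH q c d e z = contribPhi q b c d e z + contribPsi q b c d e z := by
  obtain ⟨⟨hz0, hcmul, hcdiv, hγmul, hγdiv⟩, hβmul, hβdiv⟩ := hz
  rw [mul_div_right_comm] at hγmul hβmul
  rw [← div_div] at hγdiv hβdiv
  have huv : c / d * (c / e) / (b * (c / (d * e))) = c / b := by
    have := h.c_ne
    have := h.d_ne
    have := h.e_ne
    field_simp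
  have hnorm : qPochInf q (c / b) * qPochInf q (b * (c / (d * e))) ≠ 0 :=
    mul_ne_zero (h.reg_c_div_b.qPochInf_ne_zero hq1)
      (mul_div_assoc b c _ ▸ h.reg_bc_div_de.qPochInf_ne_zero hq1)
  rw [h.contribPhi_eq_wpSeries_div hq0 hq1 hcmul hcdiv,
    h.contribPsi_eq_wpSeries_div hq0 hq1 hγmul hγdiv, ← add_div, ← wpTotal,
    wpTotal_eq hq0 hq1 hz0 (h.wpRegular hq0), huv, mul_div_assoc b, mul_comm (_ * qPochInf q _),
    mul_div_mul_right _ _ hnorm, prefA_eq_qPochPair, kernH_eq_qPochPair, div_mul_div_comm,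
    mul_comm (qPochPair q (c / (d * e)) z), ← mul_assoc (qPochPair q _ z) (qPochPair q c z),
    mul_div_mul_right _ _ (qPochPair_ne_zero hq1 hβmul hβdiv), mul_comm (qPochPair q c z)]

end Expansion

section Convergence

variable {q b c d e z : ℂ}

lemma isBigO_Phi (hq1 : ‖q‖ < 1) (hz : z ≠ 0) (hmul : QRegular q (c * z))
    (hdiv : QRegular q (c / z)) (b : ℂ) :
    (fun p : ℂ × ℕ => Phi q b c p.2 p.1) =O[𝓝 z ×ˢ ⊤] fun _ => (1 : ℝ) := by
  have hid := tendsto_id (x := 𝓝 z)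
  refine (isBigO_one_mul (isBigO_one_mul (isBigO_qPoch hq1 (hid.const_mul b))
    (isBigO_qPoch hq1 (tendsto_const_nhds (x := b).div hid hz)))
    (isBigO_one_mul (isBigO_inv_qPoch hq1 (hid.const_mul c) hmul)
      (isBigO_inv_qPoch hq1 (tendsto_const_nhds (x := c).div hid hz) hdiv))).congr_left fun p => ?_
  rw [Phi, div_eq_mul_inv _ (_ * _), mul_inv]
  rfl

lemma Generic.isBigO_coeffF (hq1 : ‖q‖ < 1) (h : Generic q b c d e) :
    (fun p : ℂ × ℕ => coeffF q b c d e p.2) =O[𝓝 z ×ˢ ⊤] fun p => q ^ p.2 := by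
  have hnum (x : ℂ) : (fun p : ℂ × ℕ => qPoch q x p.2) =O[𝓝 z ×ˢ ⊤] fun _ => (1 : ℝ) :=
    isBigO_qPoch hq1 tendsto_const_nhds
  have hinv {x : ℂ} (hx : QRegular q x) :
      (fun p : ℂ × ℕ => (qPoch q x p.2)⁻¹) =O[𝓝 z ×ˢ ⊤] fun _ => (1 : ℝ) :=
    isBigO_inv_qPoch (f := fun _ => x) hq1 tendsto_const_nhds hx
  have hwp : (fun p : ℂ × ℕ => 1 - b * c / q * q ^ (2 * p.2)) =O[𝓝 z ×ˢ ⊤] fun _ => (1 : ℝ) :=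
    (isBigO_const_const (1 : ℂ) one_ne_zero _).sub
      (isBigO_mul_pow hq1 tendsto_const_nhds fun k => 2 * k)
  have hnumerator := isBigO_one_mul (isBigO_one_mul (isBigO_one_mul (hnum (b * c / q)) (hnum d))
    (hnum e)) (hnum (c ^ 2 / (d * e * q)))
  have hdenominator := isBigO_one_mul (isBigO_one_mul (isBigO_one_mul (hinv (qRegular_self hq1))
    (hinv h.reg_bc_div_d)) (hinv h.reg_bc_div_e)) (hinv h.reg_bde_div_c.mul_q)
  have hprod := isBigO_pow_of_isBigO_one (isBigO_one_mul
    (isBigO_one_mul hwp (isBigO_const_const (1 - b * c / q)⁻¹ one_ne_zero _))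
    (isBigO_one_mul hnumerator hdenominator)) q
  refine hprod.congr_left fun p => ?_
  simp only [coeffF, mul_div_right_comm _ (q ^ _) q, mul_div_right_comm _ q c, div_eq_mul_inv,
    mul_inv]

lemma Generic.isBigO_coeffF_mul_Phi (hq1 : ‖q‖ < 1) (h : Generic q b c d e)
    (hz : z ∈ poleFree q b c d e) :
    (fun p : ℂ × ℕ => coeffF q b c d e p.2 * Phi q b c p.2 p.1) =O[𝓝 z ×ˢ ⊤] fun p => q ^ p.2 :=
  isBigO_norm_right.1 <| ((h.isBigO_coeffF hq1).norm_right.mul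
    (isBigO_Phi hq1 hz.1 hz.2.1 hz.2.2.1 b)).congr_right fun _ => mul_one _

lemma Generic.summable_coeffF_mul_Phi (hq1 : ‖q‖ < 1) (h : Generic q b c d e)
    (hz : z ∈ poleFree q b c d e) :
    Summable fun k => coeffF q b c d e k * Phi q b c k z :=
  summable_of_isBigO_pow (F := fun z k => coeffF q b c d e k * Phi q b c k z) hq1
    (h.isBigO_coeffF_mul_Phi hq1 hz)

lemma Generic.summable_coeffG_mul_Psi (hq1 : ‖q‖ < 1) (h : Generic q b c d e)
    (hz : z ∈ poleFree q b c d e) :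
    Summable fun k => coeffG q b c d e k * Psi q b c d e k z := by
  rw [h.coeffG_eq_coeffF, Psi_eq_Phi]
  exact h.involution.summable_coeffF_mul_Phi hq1 (by rwa [h.poleFree_involution])

lemma qPochPair_ne_zero_of_mem_poleFree (hq1 : ‖q‖ < 1)
    (hz : z ∈ poleFree q b c d e) : qPochPair q (c ^ 2 / (b * d * e)) z ≠ 0 := by
  obtain ⟨-, -, -, hmul, hdiv⟩ := hz
  exact qPochPair_ne_zero hq1 (by rwa [← mul_div_right_comm]) (by rwa [div_div])

lemma continuousAt_prefA (hq1 : ‖q‖ < 1) (hz : z ∈ poleFree q b c d e) :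
    ContinuousAt (prefA q b c d e) z := by
  rw [funext (prefA_eq_qPochPair q b c d e)]
  exact (continuousAt_qPochPair hq1 _ hz.1).div (continuousAt_qPochPair hq1 _ hz.1)
    (qPochPair_ne_zero_of_mem_poleFree hq1 hz)

variable {s : ℂ}

lemma Generic.taylorSum_kernH (hs0 : s ≠ 0) (hs1 : ‖s ^ 2‖ < 1) (h : Generic (s ^ 2) b c d e)
    (n : ℕ) (z : ℂ) :
    taylorSum (s ^ 2) s b c (kernH (s ^ 2) c d e) n z = kernH (s ^ 2) c d e b *
      ∑ k ∈ Finset.range (n + 1), coeffF (s ^ 2) b c d e k * Phi (s ^ 2) b c k z := by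
  simp only [taylorSum, h.taylorCoeff_kernH hs0 hs1, mul_assoc, Finset.mul_sum]

theorem Generic.prefA_mul_taylorRemainder (hs0 : s ≠ 0) (hs1 : ‖s ^ 2‖ < 1)
    (h : Generic (s ^ 2) b c d e) (hz : z ∈ admissibleH (s ^ 2) b c d e) (n : ℕ) :
    prefA (s ^ 2) b c d e z * taylorRemainder (s ^ 2) s b c (kernH (s ^ 2) c d e) n z =
      prefA (s ^ 2) b c d e z * kernH (s ^ 2) c d e b *
          (∑' k : ℕ, coeffF (s ^ 2) b c d e (n + 1 + k) * Phi (s ^ 2) b c (n + 1 + k) z) +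
        contribPsi (s ^ 2) b c d e z := by
  have hsplit := (h.summable_coeffF_mul_Phi hs1 hz.1).sum_add_tsum_nat_add (n + 1)
  simp only [add_comm _ (n + 1)] at hsplit
  rw [taylorRemainder, h.taylorSum_kernH hs0 hs1, mul_sub,
    h.prefA_mul_kernH (pow_ne_zero 2 hs0) hs1 hz, contribPhi, ← hsplit]
  ring

theorem Generic.tendstoUniformlyOn_taylorRemainder (hs0 : s ≠ 0) (hs1 : ‖s ^ 2‖ < 1)
    (h : Generic (s ^ 2) b c d e) {L : Set ℂ} (hL : IsCompact L)
    (hsub : L ⊆ admissibleH (s ^ 2) b c d e) :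
    TendstoUniformlyOn
      (fun (n : ℕ) (z : ℂ) => prefA (s ^ 2) b c d e z *
        taylorRemainder (s ^ 2) s b c (kernH (s ^ 2) c d e) n z)
      (contribPsi (s ^ 2) b c d e) atTop L := by
  have hbound : ∀ z ∈ L, (fun p : ℂ × ℕ => prefA (s ^ 2) b c d e p.1 * kernH (s ^ 2) c d e b *
      (coeffF (s ^ 2) b c d e p.2 * Phi (s ^ 2) b c p.2 p.1)) =O[𝓝 z ×ˢ ⊤]
        fun p => (s ^ 2) ^ p.2 := fun z hz =>
    isBigO_norm_right.1 <| ((isBigO_comp_fst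
      ((continuousAt_prefA hs1 (hsub hz).1).tendsto.mul_const (kernH (s ^ 2) c d e b))).mul
      (h.isBigO_coeffF_mul_Phi hs1 (hsub hz).1).norm_right).congr_right fun _ => one_mul _
  have hseries := tendstoUniformlyOn_sum_range_of_isBigO_pow (F := fun z k =>
    prefA (s ^ 2) b c d e z * kernH (s ^ 2) c d e b *
      (coeffF (s ^ 2) b c d e k * Phi (s ^ 2) b c k z)) hs1 hL hbound
  rw [Metric.tendstoUniformlyOn_iff] at hseries ⊢
  intro ε hε
  filter_upwards [(tendsto_add_atTop_nat 1).eventually (hseries ε hε)] with n hn z hz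
  specialize hn z hz
  rw [tsum_mul_left, ← contribPhi, ← Finset.mul_sum] at hn
  rwa [taylorRemainder, h.taylorSum_kernH hs0 hs1, mul_sub,
    h.prefA_mul_kernH (pow_ne_zero 2 hs0) hs1 (hsub hz), ← mul_assoc, dist_comm, dist_eq_norm,
    add_sub_right_comm, add_sub_cancel_right, ← dist_eq_norm]

end Convergence

section Nonvanishing

variable {q b c d e : ℂ}

lemma dense_admissibleK (q b c d e : ℂ) : Dense (admissibleK q b c d e) := by
  have hpair (x : ℂ) : {z | ¬(QRegular q (x * z) ∧ QRegular q (x / z))}.Countable :=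
    ((countable_not_qRegular_mul q x).union (countable_not_qRegular_div q x)).mono
      fun _ => not_and_or.1
  have hcountable := ((Set.countable_singleton (0 : ℂ)).union (hpair c)).union
    ((hpair (c ^ 2 / (b * d * e))).union (hpair b))
  refine (hcountable.dense_compl ℂ).mono fun z hz => ?_
  simp only [Set.mem_compl_iff, Set.mem_union, Set.mem_singleton_iff, Set.mem_ofPred_eq, not_or,
    not_not] at hz
  simp only [admissibleK, poleFree, Set.mem_ofPred_eq, ← div_div _ _ z, mul_div_right_comm _ z]
  tauto

lemma wpMonomial_self_succ {b : ℂ} (hb : b ≠ 0) (q c : ℂ) (k : ℕ) :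
    wpMonomial q b c b (k + 1) = 0 := by
  rw [wpMonomial, div_self hb, qPoch_one_succ, mul_zero, zero_mul]

lemma coeffF_zero (hbc : 1 - b * c / q ≠ 0) (d e : ℂ) : coeffF q b c d e 0 = 1 := by
  simp only [coeffF, mul_zero, pow_zero, mul_one, qPoch_zero, div_self hbc, div_one]

lemma Generic.wpSeries_self_ne_zero (hq0 : q ≠ 0) (hq1 : ‖q‖ < 1) (h : Generic q b c d e)
    (hH : kernH q c d e b ≠ 0) : wpSeries q b (c / (d * e)) (c / d) (c / e) b ≠ 0 := by
  have huv : c / d * (c / e) / (c / (d * e)) = c := by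
    have := h.c_ne
    have := h.d_ne
    have := h.e_ne
    field_simp
  have hcoeff : wpCoeff q b (c / (d * e)) (c / d) (c / e) 0 ≠ 0 := fun hzero => hH <| by
    simpa only [coeffF_zero (h.reg_bc.div_q hq0 h.bc_ne_q).one_sub_ne_zero, hzero, mul_one,
      zero_mul, zero_div] using h.kernH_mul_coeffF hq0 hq1 0
  have hpair : qPochPair q (c / (d * e)) b ≠ 0 :=
    qPochPair_ne_zero hq1 (by convert h.reg_bc_div_de using 1; ring)
      (by convert h.reg_c_div_bde using 1; field_simp)
  have hmonomial : wpMonomial q b c b 0 ≠ 0 := by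
    simpa only [wpMonomial, qPoch_zero, pow_zero, mul_one, one_mul, mul_comm c b] using
      mul_ne_zero (h.reg_bc.qPochInf_ne_zero hq1) (h.reg_c_div_b.qPochInf_ne_zero hq1)
  rw [wpSeries, huv, tsum_eq_single 0]
  · simpa only [pow_zero, mul_one] using mul_ne_zero hpair (mul_ne_zero hcoeff hmonomial)
  · intro k hk
    obtain ⟨m, rfl⟩ := Nat.exists_eq_succ_of_ne_zero hk
    rw [wpMonomial_self_succ h.b_ne, mul_zero, zero_mul]

theorem Generic.exists_contribPhi_ne_zero (hq0 : q ≠ 0) (hq1 : ‖q‖ < 1) (h : Generic q b c d e)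
    (hH : kernH q c d e b ≠ 0) : ∃ z ∈ admissibleK q b c d e, contribPhi q b c d e z ≠ 0 := by
  have hnear : ∀ᶠ z in 𝓝 b, wpSeries q b (c / (d * e)) (c / d) (c / e) z ≠ 0 :=
    (tendsto_wpSeries hq1 h.b_ne (h.wpRegular hq0) tendsto_const_nhds tendsto_const_nhds
      tendsto_id).eventually_ne (h.wpSeries_self_ne_zero hq0 hq1 hH)
  obtain ⟨z, hz, hne⟩ := ((mem_closure_iff_frequently.1
    (dense_admissibleK q b c d e b)).and_eventually hnear).exists
  refine ⟨z, hz, ?_⟩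
  obtain ⟨hpole, -⟩ := hz
  rw [h.contribPhi_eq_wpSeries_div hq0 hq1 hpole.2.1 hpole.2.2.1]
  exact div_ne_zero hne (mul_ne_zero (mul_ne_zero (h.reg_c_div_b.qPochInf_ne_zero hq1)
    (h.reg_bc_div_de.qPochInf_ne_zero hq1)) (mul_ne_zero
      (qPochPair_ne_zero hq1 hpole.2.1 hpole.2.2.1)
      (qPochPair_ne_zero_of_mem_poleFree hq1 hpole)))

end Nonvanishing

end WPTaylor

theorem mainTheorem2 (q s b c d e : ℂ) (hq0 : 0 < ‖q‖) (hq1 : ‖q‖ < 1) (hs : s ^ 2 = q)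
    (hgen : WPTaylor.Generic q b c d e) :
    -- the remainder of `H` relative to `(b, c)`
    ((∀ z ∈ WPTaylor.admissibleH q b c d e,
        Summable (fun k : ℕ => WPTaylor.coeffF q b c d e k * WPTaylor.Phi q b c k z) ∧
        Summable (fun k : ℕ => WPTaylor.coeffG q b c d e k * WPTaylor.Psi q b c d e k z) ∧
        ∀ n : ℕ,
          WPTaylor.prefA q b c d e z *
              WPTaylor.taylorRemainder q s b c (WPTaylor.kernH q c d e) n z =
            WPTaylor.prefA q b c d e z * WPTaylor.kernH q c d e b *
                (∑' k : ℕ, WPTaylor.coeffF q b c d e (n + 1 + k) *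
                  WPTaylor.Phi q b c (n + 1 + k) z) +
              WPTaylor.contribPsi q b c d e z) ∧
      (∀ L : Set ℂ, IsCompact L → L ⊆ WPTaylor.admissibleH q b c d e →
        TendstoUniformlyOn
          (fun (n : ℕ) (z : ℂ) => WPTaylor.prefA q b c d e z *
            WPTaylor.taylorRemainder q s b c (WPTaylor.kernH q c d e) n z)
          (WPTaylor.contribPsi q b c d e) Filter.atTop L) ∧
      (WPTaylor.kernK q b c d e (c / (d * e)) ≠ 0 →
        ∃ z ∈ WPTaylor.admissibleH q b c d e, WPTaylor.contribPsi q b c d e z ≠ 0)) ∧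
    -- the remainder of `K` relative to `(c/de, c²/bde)`
    ((∀ z ∈ WPTaylor.admissibleK q b c d e,
        Summable (fun k : ℕ => WPTaylor.coeffF q b c d e k * WPTaylor.Phi q b c k z) ∧
        Summable (fun k : ℕ => WPTaylor.coeffG q b c d e k * WPTaylor.Psi q b c d e k z) ∧
        ∀ n : ℕ,
          WPTaylor.prefB q b c z *
              WPTaylor.taylorRemainder q s (c / (d * e)) (c ^ 2 / (b * d * e))
                (WPTaylor.kernK q b c d e) n z =
            WPTaylor.prefB q b c z * WPTaylor.kernK q b c d e (c / (d * e)) *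
                (∑' k : ℕ, WPTaylor.coeffG q b c d e (n + 1 + k) *
                  WPTaylor.Psi q b c d e (n + 1 + k) z) +
              WPTaylor.contribPhi q b c d e z) ∧
      (∀ L : Set ℂ, IsCompact L → L ⊆ WPTaylor.admissibleK q b c d e →
        TendstoUniformlyOn
          (fun (n : ℕ) (z : ℂ) => WPTaylor.prefB q b c z *
            WPTaylor.taylorRemainder q s (c / (d * e)) (c ^ 2 / (b * d * e))
              (WPTaylor.kernK q b c d e) n z)
          (WPTaylor.contribPhi q b c d e) Filter.atTop L) ∧
      (WPTaylor.kernH q c d e b ≠ 0 →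
        ∃ z ∈ WPTaylor.admissibleK q b c d e, WPTaylor.contribPhi q b c d e z ≠ 0)) := by
  have hq0' : q ≠ 0 := norm_pos_iff.1 hq0
  subst hs
  have hs0 : s ≠ 0 := ne_zero_pow two_ne_zero hq0'
  have hinv := hgen.involution
  refine ⟨⟨fun z hz => ⟨hgen.summable_coeffF_mul_Phi hq1 hz.1,
      hgen.summable_coeffG_mul_Psi hq1 hz.1, hgen.prefA_mul_taylorRemainder hs0 hq1 hz⟩,
    fun L hL hsub => hgen.tendstoUniformlyOn_taylorRemainder hs0 hq1 hL hsub, fun hK => ?_⟩,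
    fun z hz => ⟨hgen.summable_coeffF_mul_Phi hq1 hz.1, hgen.summable_coeffG_mul_Psi hq1 hz.1,
      fun n => ?_⟩,
    fun L hL hsub => ?_, hgen.exists_contribPhi_ne_zero hq0' hq1⟩
  · rw [hgen.kernK_eq_kernH] at hK
    rw [hgen.admissibleH_eq_admissibleK, hgen.contribPsi_eq_contribPhi]
    exact hinv.exists_contribPhi_ne_zero hq0' hq1 hK
  · rw [hgen.admissibleK_eq_admissibleH] at hz
    rw [hgen.prefB_eq_prefA, hgen.kernK_eq_kernH, hgen.coeffG_eq_coeffF, WPTaylor.Psi_eq_Phi,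
      hgen.contribPhi_eq_contribPsi]
    exact hinv.prefA_mul_taylorRemainder hs0 hq1 hz n
  · rw [hgen.admissibleK_eq_admissibleH] at hsub
    rw [hgen.prefB_eq_prefA, hgen.kernK_eq_kernH, hgen.contribPhi_eq_contribPsi]
    exact hinv.tendstoUniformlyOn_taylorRemainder hs0 hq1 hL hsub
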